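/- Let $(X,\mu)$ be a $\sigma$-finite measure space and $\omega:X\to\mathbb R$ measurable with $\omega\ge m$ for some constant $m>0$. Let $\mathcal H=L^2(X,\mu)$, let $\mathcal F$ be the symmetric Fock space over $\mathcal H$, i.e. the Hilbert space of sequences $\Psi=(\Psi^{(n)})_{n\ge0}$ with $\Psi^{(n)}\in L^2(X^n,\mu^n)$ symmetric in its variables and $\|\Psi\|^2=\sum_n\|\Psi^{(n)}\|^2<\infty$ (with $L^2(X^0)=\mathbb C$). For $r\in\mathbb R$ let $\mathcal H_r$ be the Hilbert space of measurable $\psi$ with $\|\psi\|_r^2=\int\omega^r|\psi|^2\,d\mu<\infty$, and let $\mathcal F_r$ be the Hilbert space of sequences of symmetric measurable functions with $$\|\Psi\|_{\mathcal F_r}^2=\bigl\|(d\Gamma(\omega)+1)^{r/2}\Psi\bigr\|^2=\sum_n\int\Bigl(\sum_{j=1}^n\omega(k_j)+1\Bigr)^{r}|\Psi^{(n)}(k_1,\dots,k_n)|^2\,d^n\mu<\infty .$$ Scalar products are antilinear in the first argument, and $\mathcal F_{-r}$, $\mathcal F_{+r}$ are paired by $$(\Psi,\Phi)_{\mathcal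 F_{-r},\mathcal F_{+r}}=\bigl\langle (d\Gamma(\omega)+1)^{-r/2}\Psi,(d\Gamma(\omega)+1)^{r/2}\Phi\bigr\rangle_{\mathcal F}.$$ Let $s\ge1$ and $f\in\mathcal H_{-s}$, and let $\tilde a(f):\mathcal F_{+s}\to\mathcal F$ be the bounded operator given, for $n\ge0$, by $$(\tilde a(f)\Phi)^{(n)}(k_1,\dots,k_n)=\sqrt{n+1}\int\overline{f(x)}\,\Phi^{(n+1)}(k_1,\dots,k_n,x)\,d\mu(x)$$ (that this formula does define such an operator is part of the claim). Then there is a unique bounded operator $\tilde a^\dagger(f):\mathcal F\to\mathcal F_{-s}$ such that $$\langle\Psi,\tilde a(f)\Phi\rangle_{\mathcal F}=\bigl(\tilde a^\dagger(f)\Psi,\Phi\bigr)_{\mathcal F_{-s},\mathcal F_{+s}}\qquad\text{for all }\Phi\in\mathcal F_{+s},\ \Psi\in\mathcal F,$$ and its operator norm satisfies $\|\tilde a^\dagger(f)\|\le\|f\|_{-s}$. For all $\Psi\in\mathcal F_{+s}$, the vacuum component of $\tilde a^\dagger(f)\Psi$ is $0$ and, for $n\ge0$, $$(\tilde a^\dagger(f)\Psi)^{(n+1)}(k_1,\dots,k_{n+1})=\frac1{\sqrt{n+1}}\Bigl(\sum_{j=1}^n\Psi^{(n)}(k_1,\dots,\overbrace{k_{n+1}}^{j\text{th}},\dots,k_n)f(k_j)+\Psi^{(n)}(k_1,\dots,k_n)f(k_{n+1})\Bigr).\qquad(*)$$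 Finally, suppose $f\in\mathcal H$, and let $a^\dagger(f)$ be the regular creation operator on $\mathcal F$, which acts by $(*)$ on the domain of all $\Psi\in\mathcal F$ with $\sum_n(n+1)\int\bigl|\int\overline{f(x)}\Psi^{(n+1)}(k_1,\dots,k_n,x)\,d\mu(x)\bigr|^2d^n\mu<\infty$. Then every $\Psi\in\mathcal F_{+1}$ lies in this domain and $\tilde a^\dagger(f)\Psi=a^\dagger(f)\Psi$. -/

import Mathlib

open MeasureTheory ComplexConjugate

open scoped ENNReal

noncomputable section

namespace SingularFock

variable {X : Type*} [MeasurableSpace X]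

/-! ### Product measures, weights and permutations -/

/-- The product measure `μⁿ` on `Xⁿ`; for `n = 0` it is the unit mass on the one-point space,
so that `L²(X⁰) = ℂ`. -/
def nMeasure (μ : Measure X) [SigmaFinite μ] (n : ℕ) : Measure (Fin n → X) :=
  Measure.pi fun _ => μ

/-- The symbol `∑ⱼ ω(kⱼ) + 1` of the multiplication operator `dΓ(ω) + 1` on `n` particles. -/
def weight (ω : X → ℝ) (n : ℕ) (k : Fin n → X) : ℝ := (∑ j, ω (k j)) + 1

/-- The measure `(∑ⱼ ω(kⱼ) + 1)^s dⁿμ` on `Xⁿ`. -/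
def scaleMeasure (μ : Measure X) [SigmaFinite μ] (ω : X → ℝ) (s : ℝ) (n : ℕ) :
    Measure (Fin n → X) :=
  (nMeasure μ n).withDensity fun k => ENNReal.ofReal (weight ω n k ^ s)

/-- A measure on `Xⁿ` is invariant under permutations of the coordinates. -/
def PermInvariant {n : ℕ} (ν : Measure (Fin n → X)) : Prop :=
  ∀ σ : Equiv.Perm (Fin n), MeasurePreserving (fun k : Fin n → X => fun i => k (σ i)) ν ν

theorem coe_piCongrLeft_symm {n : ℕ} (σ : Equiv.Perm (Fin n)) :
    ⇑(MeasurableEquiv.piCongrLeft (fun _ : Fin n => X) σ.symm) =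
      fun (k : Fin n → X) (i : Fin n) => k (σ i) := by
  funext k i
  obtain ⟨j, rfl⟩ := σ.symm.surjective i
  rw [MeasurableEquiv.coe_piCongrLeft, Equiv.piCongrLeft_apply_apply, Equiv.apply_symm_apply]

theorem nMeasure_permInvariant (μ : Measure X) [SigmaFinite μ] (n : ℕ) :
    PermInvariant (nMeasure μ n) := by
  intro σ
  rw [← coe_piCongrLeft_symm σ]
  exact measurePreserving_piCongrLeft (fun _ : Fin n => μ) σ.symm

theorem scaleMeasure_permInvariant (μ : Measure X) [SigmaFinite μ] (ω : X → ℝ) (s : ℝ) (n : ℕ) :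
    PermInvariant (scaleMeasure μ ω s n) := by
  intro σ
  have h := nMeasure_permInvariant μ n σ
  have he : MeasurableEmbedding (fun (k : Fin n → X) (i : Fin n) => k (σ i)) := by
    rw [← coe_piCongrLeft_symm σ]
    exact MeasurableEquiv.measurableEmbedding _
  have hw : ∀ k : Fin n → X, weight ω n (fun i => k (σ i)) = weight ω n k := fun k => by
    simp only [weight, Equiv.sum_comp σ (fun i => ω (k i))]
  refine ⟨h.measurable, ?_⟩
  ext t ht
  rw [Measure.map_apply h.measurable ht, scaleMeasure, withDensity_apply _ (h.measurable ht),
    withDensity_apply _ ht, ← h.setLIntegral_comp_preimage_emb he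
      (fun k => ENNReal.ofReal (weight ω n k ^ s)) t]
  simp only [hw]

/-! ### Symmetric Fock spaces and the two scales of Hilbert spaces -/

/-- The Hilbert space of sequences `Ψ = (Ψ⁽ⁿ⁾)`, `Ψ⁽ⁿ⁾ ∈ L²(Xⁿ, νₙ)`, with `∑ₙ ‖Ψ⁽ⁿ⁾‖² < ∞` and
every `Ψ⁽ⁿ⁾` almost everywhere invariant under permutations of its variables. -/
def symmetricSum (ν : ∀ n : ℕ, Measure (Fin n → X)) (hν : ∀ n, PermInvariant (ν n)) :
    Submodule ℂ (lp (fun n => Lp ℂ 2 (ν n)) 2) where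
  carrier := {Ψ | ∀ (n : ℕ) (σ : Equiv.Perm (Fin n)),
    (fun k : Fin n → X => (Ψ n) (fun i => k (σ i))) =ᵐ[ν n] Ψ n}
  zero_mem' := by
    intro n σ
    have h0 := Lp.coeFn_zero ℂ 2 (ν n)
    have h1 := (hν n σ).quasiMeasurePreserving.ae h0
    filter_upwards [h0, h1] with k hk hk'
    exact hk'.trans hk.symm
  add_mem' := by
    intro Ψ Φ hΨ hΦ n σ
    have h0 := Lp.coeFn_add (Ψ n) (Φ n)
    have h1 := (hν n σ).quasiMeasurePreserving.ae h0
    filter_upwards [h0, h1, hΨ n σ, hΦ n σ] with k hk hk' h2 h3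
    refine hk'.trans (Eq.trans ?_ hk.symm)
    simp only [Pi.add_apply, h2, h3]
  smul_mem' := by
    intro c Ψ hΨ n σ
    have h0 := Lp.coeFn_smul c (Ψ n)
    have h1 := (hν n σ).quasiMeasurePreserving.ae h0
    filter_upwards [h0, h1, hΨ n σ] with k hk hk' h2
    refine hk'.trans (Eq.trans ?_ hk.symm)
    simp only [Pi.smul_apply, h2]

/-- The symmetric Fock space `𝓕` over `𝓗 = L²(X, μ)`. -/
abbrev Fock (μ : Measure X) [SigmaFinite μ] : Type _ :=
  symmetricSum (nMeasure μ) (nMeasure_permInvariant μ)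

/-- The space `𝓕ₛ` of the `dΓ(ω)`-scale: the completion for the norm `‖(dΓ(ω) + 1)^{s/2} Ψ‖`.
As `dΓ(ω)` is multiplication by `∑ⱼ ω(kⱼ)`, this consists of all sequences of symmetric
functions with `‖Ψ‖² = ∑ₙ ∫ (∑ⱼ ω(kⱼ) + 1)^s |Ψ⁽ⁿ⁾|² dⁿμ < ∞`. -/
abbrev FockScale (μ : Measure X) [SigmaFinite μ] (ω : X → ℝ) (s : ℝ) : Type _ :=
  symmetricSum (scaleMeasure μ ω s) (scaleMeasure_permInvariant μ ω s)

/-- The space `𝓗ₛ` of the `ω`-scale, with `‖ψ‖ₛ² = ∫ ω(k)^s |ψ(k)|² dμ`. -/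
abbrev OneParticleScale (μ : Measure X) (ω : X → ℝ) (s : ℝ) : Type _ :=
  Lp ℂ 2 (μ.withDensity fun x => ENNReal.ofReal (ω x ^ s))

/-- The component functions of an element of `𝓕`. -/
def Fock.toFun {μ : Measure X} [SigmaFinite μ] (Ψ : Fock μ) (n : ℕ) : (Fin n → X) → ℂ :=
  (Ψ : lp (fun n => Lp ℂ 2 (nMeasure μ n)) 2) n

/-- The component functions of an element of `𝓕ₛ`. -/
def FockScale.toFun {μ : Measure X} [SigmaFinite μ] {ω : X → ℝ} {s : ℝ} (Ψ : FockScale μ ω s)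
    (n : ℕ) : (Fin n → X) → ℂ :=
  (Ψ : lp (fun n => Lp ℂ 2 (scaleMeasure μ ω s n)) 2) n

/-- `Ψ ∈ 𝓕` belongs to `𝓕ₛ`: its components are those of an element of `𝓕ₛ`. -/
def MemScale {μ : Measure X} [SigmaFinite μ] (ω : X → ℝ) (s : ℝ) (Ψ : Fock μ) : Prop :=
  ∃ Φ : FockScale μ ω s, ∀ n, Ψ.toFun n =ᵐ[nMeasure μ n] Φ.toFun n

/-- The duality pairing `(Ψ, Φ) = ⟨(dΓ(ω) + 1)^{-s/2} Ψ, (dΓ(ω) + 1)^{s/2} Φ⟩` of `Ψ ∈ 𝓕₋ₛ` and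
`Φ ∈ 𝓕₊ₛ`, the right-hand side being the scalar product of `𝓕`, antilinear on the left. -/
def pairing {μ : Measure X} [SigmaFinite μ] {ω : X → ℝ} {s : ℝ}
    (Ψ : FockScale μ ω (-s)) (Φ : FockScale μ ω s) : ℂ :=
  ∑' n, ∫ k, conj (((weight ω n k ^ (-s / 2) : ℝ) : ℂ) * Ψ.toFun n k) *
    (((weight ω n k ^ (s / 2) : ℝ) : ℂ) * Φ.toFun n k) ∂(nMeasure μ n)

/-! ### Creation and annihilation -/

/-- The annihilation expression: the `n`-particle component is
`√(n+1) ∫ conj f(x) Ψ⁽ⁿ⁺¹⁾(k₁, …, kₙ, x) dμ(x)`. -/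
def annihilationFun (μ : Measure X) (f : X → ℂ) (Ψ : ∀ n : ℕ, (Fin n → X) → ℂ) (n : ℕ)
    (k : Fin n → X) : ℂ :=
  (Real.sqrt (n + 1) : ℂ) * ∫ x, conj (f x) * Ψ (n + 1) (Fin.snoc k x) ∂μ

/-- The creation expression: its vacuum component is `0`, its `(n+1)`-particle component is
`(n+1)^{-1/2} (∑ⱼ Ψ⁽ⁿ⁾(k₁, …, kₙ₊₁, …, kₙ) f(kⱼ) + Ψ⁽ⁿ⁾(k₁, …, kₙ) f(kₙ₊₁))`,
where in the `j`-th summand `kₙ₊₁` stands in place of `kⱼ`. -/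
def creationFun (f : X → ℂ) (Ψ : ∀ n : ℕ, (Fin n → X) → ℂ) : ∀ n : ℕ, (Fin n → X) → ℂ
  | 0, _ => 0
  | n + 1, k => (1 / Real.sqrt (n + 1) : ℂ) *
      (∑ j : Fin n, Ψ n (Function.update (Fin.init k) j (k (Fin.last n))) * f (k j.castSucc)
        + Ψ n (Fin.init k) * f (k (Fin.last n)))

/-- The common domain of the regular operators `a(g)`, `a†(g)`, for `g ∈ 𝓗`: those `Ψ ∈ 𝓕` with
`∑ₙ ‖(a(g)Ψ)⁽ⁿ⁾‖² < ∞`. -/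
def regularDomain {μ : Measure X} [SigmaFinite μ] (g : Lp ℂ 2 μ) : Set (Fock μ) :=
  {Ψ | ∑' n, ∫⁻ k, ‖annihilationFun μ g Ψ.toFun n k‖ₑ ^ 2 ∂(nMeasure μ n) < ∞}

/-- `Ψ` lies in the domain of the regular creation operator `a†(g)` on `𝓕`, and `a†(g)Ψ = Ξ`. -/
def IsRegularCreation {μ : Measure X} [SigmaFinite μ] (g : Lp ℂ 2 μ) (Ψ Ξ : Fock μ) : Prop :=
  Ψ ∈ regularDomain g ∧ ∀ n, Ξ.toFun n =ᵐ[nMeasure μ n] creationFun g Ψ.toFun n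

/-- The bounded operator `A : 𝓕₊ₛ → 𝓕` is the singular annihilation operator of `f`: it acts by
the annihilation expression. -/
def IsSingularAnnihilation {μ : Measure X} [SigmaFinite μ] {ω : X → ℝ} {s : ℝ}
    (f : OneParticleScale μ ω (-s)) (A : FockScale μ ω s →L[ℂ] Fock μ) : Prop :=
  ∀ (Φ : FockScale μ ω s) (n : ℕ),
    (A Φ).toFun n =ᵐ[nMeasure μ n] annihilationFun μ f Φ.toFun n

/-- `B : 𝓕 → 𝓕₋ₛ` is adjoint to `A : 𝓕₊ₛ → 𝓕` with respect to the duality pairing. -/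
def IsPairingAdjoint {μ : Measure X} [SigmaFinite μ] {ω : X → ℝ} {s : ℝ}
    (A : FockScale μ ω s →L[ℂ] Fock μ) (B : Fock μ →L[ℂ] FockScale μ ω (-s)) : Prop :=
  ∀ (Φ : FockScale μ ω s) (Ψ : Fock μ), inner ℂ Ψ (A Φ) = pairing (B Ψ) Φ

end SingularFock

end

noncomputable section

namespace SingularFock

variable {X : Type*} [MeasurableSpace X]

/-! ### Weighted Cauchy–Schwarz inequalities -/

/-! Everything rests on Cauchy–Schwarz with a weight, `(∫ uv)² ≤ ∫ a⁻¹u² · ∫ a v²`, taken with `a =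
ω ^ s`, so that the first factor becomes `‖f‖²` in `𝓗₋ₛ`.

For annihilation it is applied in the integrated variable. The factor `n + 1` and the symmetry of
`Φ⁽ⁿ⁺¹⁾` turn `a(kₙ₊₁)` into `∑ⱼ a(kⱼ)`, and `∑ⱼ ω(kⱼ)^s ≤ (∑ⱼ ω(kⱼ) + 1)^s` for `s ≥ 1`
(`lintegral_annihilationFun_sq_le`, `sum_ofReal_rpow_le`).

The creation operator is not obtained by abstract duality: formula (*) defines it on all of `𝓕`. By
symmetry (*) equals `(n+1)^{-1/2} ∑ⱼ Ψ⁽ⁿ⁾(k without kⱼ) f(kⱼ)`, and Cauchy–Schwarz for finite sums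
gives the norm bound `‖f‖` (`creationFun_succ_ae`, `lintegral_creationFun_sq_le`). Fubini and
symmetry make the two expressions adjoint (`integral_creation_annihilation`).

Uniqueness holds because the pairing becomes the inner product of `𝓕₊ₛ` after multiplication by
`(dΓ(ω) + 1)^{-s}` (`exists_pairing_eq_inner`). For `f ∈ 𝓗` the same estimates with `a = 1` produce
the particle number, which `dΓ(ω) + 1` controls since `ω ≥ m > 0` (`tsum_number_lt_top`). -/

theorem sq_lintegral_mul_le {α : Type*} [MeasurableSpace α] {ν : Measure α} {a u v : α → ℝ≥0∞}
    (ha : Measurable a) (hu : Measurable u) (hv : Measurable v)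
    (ha0 : ∀ x, a x ≠ 0) (hat : ∀ x, a x ≠ ∞) :
    (∫⁻ x, u x * v x ∂ν) ^ 2 ≤ (∫⁻ x, (a x)⁻¹ * u x ^ 2 ∂ν) * ∫⁻ x, a x * v x ^ 2 ∂ν := by
  -- Hölder with exponents 1/2, 1/2 for `a⁻¹u²` and `av²`, whose product is `(uv)²` because `a` is
  -- never `0` or `∞`.
  have h := ENNReal.lintegral_mul_norm_pow_le (μ := ν) (f := fun x => (a x)⁻¹ * u x ^ 2)
    (g := fun x => a x * v x ^ 2) (ha.inv.mul (hu.pow_const 2)).aemeasurable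
    (ha.mul (hv.pow_const 2)).aemeasurable (p := 1 / 2) (q := 1 / 2)
    (by norm_num) (by norm_num) (by norm_num)
  have e : ∀ x, u x * v x = ((a x)⁻¹ * u x ^ 2) ^ (1 / 2 : ℝ) * (a x * v x ^ 2) ^ (1 / 2 : ℝ) := by
    intro x
    rw [← ENNReal.mul_rpow_of_nonneg _ _ (by norm_num : (0 : ℝ) ≤ 1 / 2)]
    have : (a x)⁻¹ * u x ^ 2 * (a x * v x ^ 2) = (u x * v x) ^ (2 : ℝ) := by
      rw [ENNReal.rpow_two]
      calc _ = ((a x)⁻¹ * a x) * (u x * v x) ^ 2 := by ring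
        _ = _ := by rw [ENNReal.inv_mul_cancel (ha0 x) (hat x), one_mul]
    rw [this, ← ENNReal.rpow_mul]
    norm_num
  simp_rw [e]
  calc _ ≤ _ := pow_le_pow_left' h 2
    _ = _ := by
      rw [← ENNReal.mul_rpow_of_nonneg _ _ (by norm_num : (0 : ℝ) ≤ 1 / 2), ← ENNReal.rpow_two,
        ← ENNReal.rpow_mul]
      norm_num

theorem sq_sum_le {ι : Type*} [Fintype ι] (a u : ι → ℝ≥0∞)
    (ha0 : ∀ i, a i ≠ 0) (hat : ∀ i, a i ≠ ∞) :
    (∑ i, u i) ^ 2 ≤ (∑ i, (a i)⁻¹ * u i ^ 2) * ∑ i, a i := by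
  let _ : MeasurableSpace ι := ⊤
  have h := sq_lintegral_mul_le (ν := (Measure.count : Measure ι)) (a := a) (u := u)
    (v := fun _ => 1) measurable_from_top measurable_from_top measurable_from_top ha0 hat
  simpa [lintegral_count, tsum_fintype] using h

instance (μ : Measure X) [SigmaFinite μ] (n : ℕ) : SigmaFinite (nMeasure μ n) := by
  unfold nMeasure; infer_instance

/-! ### Splitting off one coordinate -/

section Coordinates

variable (μ : Measure X) [SigmaFinite μ] {n : ℕ}

theorem measurePreserving_removeNth (i : Fin (n + 1)) :
    MeasurePreserving (fun k : Fin (n + 1) → X => (k i, i.removeNth k)) (nMeasure μ (n + 1))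
      (μ.prod (nMeasure μ n)) :=
  measurePreserving_piFinSuccAbove (fun _ => μ) i

theorem measurePreserving_snoc :
    MeasurePreserving (fun p : X × (Fin n → X) => (Fin.snoc p.2 p.1 : Fin (n + 1) → X))
      (μ.prod (nMeasure μ n)) (nMeasure μ (n + 1)) := by
  have h := (measurePreserving_piFinSuccAbove (fun _ : Fin (n + 1) => μ) (Fin.last n)).symm
  have e : (fun p : X × (Fin n → X) => (Fin.snoc p.2 p.1 : Fin (n + 1) → X)) =
      (MeasurableEquiv.piFinSuccAbove (fun _ : Fin (n + 1) => X) (Fin.last n)).symm :=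
    funext fun p => (Fin.insertNth_last' p.1 p.2).symm
  rw [e]
  exact h

theorem measurableEmbedding_snoc :
    MeasurableEmbedding (fun p : X × (Fin n → X) => (Fin.snoc p.2 p.1 : Fin (n + 1) → X)) := by
  convert (MeasurableEquiv.piFinSuccAbove (fun _ : Fin (n + 1) => X)
    (Fin.last n)).symm.measurableEmbedding using 1
  funext p
  exact (Fin.insertNth_last' p.1 p.2).symm

theorem lintegral_snoc {F : (Fin (n + 1) → X) → ℝ≥0∞} (hF : Measurable F) :
    ∫⁻ k, F k ∂nMeasure μ (n + 1) = ∫⁻ k, ∫⁻ x, F (Fin.snoc k x) ∂μ ∂nMeasure μ n := by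
  rw [← (measurePreserving_snoc μ).lintegral_comp hF,
    lintegral_prod_symm' (fun p : X × (Fin n → X) => F (Fin.snoc p.2 p.1))
      (hF.comp (measurePreserving_snoc μ).measurable)]

theorem integral_snoc {F : (Fin (n + 1) → X) → ℂ} (hF : Integrable F (nMeasure μ (n + 1))) :
    ∫ k, F k ∂nMeasure μ (n + 1) = ∫ k, ∫ x, F (Fin.snoc k x) ∂μ ∂nMeasure μ n := by
  rw [← (measurePreserving_snoc μ).integral_comp measurableEmbedding_snoc]
  exact integral_prod_symm _
    (((measurePreserving_snoc μ).integrable_comp_emb measurableEmbedding_snoc).2 hF)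

theorem ae_snoc {p : (Fin (n + 1) → X) → Prop} (h : ∀ᵐ k ∂nMeasure μ (n + 1), p k) :
    ∀ᵐ k ∂nMeasure μ n, ∀ᵐ x ∂μ, p (Fin.snoc k x) := by
  have h1 := ((measurePreserving_snoc μ).comp (Measure.measurePreserving_swap
    (μ := nMeasure μ n) (ν := μ))).quasiMeasurePreserving.ae h
  exact Measure.ae_ae_of_ae_prod h1

theorem ae_removeNth (i : Fin (n + 1)) {p : (Fin n → X) → Prop} (h : ∀ᵐ k ∂nMeasure μ n, p k) :
    ∀ᵐ k ∂nMeasure μ (n + 1), p (i.removeNth k) := by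
  exact (Measure.quasiMeasurePreserving_snd.comp
    (measurePreserving_removeNth μ i).quasiMeasurePreserving).ae h

theorem ae_eval (i : Fin n) {p : X → Prop} (h : ∀ᵐ x ∂μ, p x) :
    ∀ᵐ k ∂nMeasure μ n, p (k i) :=
  (Measure.quasiMeasurePreserving_eval (fun _ : Fin n => μ) i).ae h

theorem lintegral_mul_removeNth (i : Fin (n + 1)) {G : X → ℝ≥0∞} {H : (Fin n → X) → ℝ≥0∞}
    (hG : Measurable G) (hH : Measurable H) :
    ∫⁻ k, G (k i) * H (i.removeNth k) ∂nMeasure μ (n + 1) =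
      (∫⁻ x, G x ∂μ) * ∫⁻ k, H k ∂nMeasure μ n := by
  rw [← lintegral_prod_mul hG.aemeasurable hH.aemeasurable]
  exact (measurePreserving_removeNth μ i).lintegral_comp
    ((hG.comp measurable_fst).mul (hH.comp measurable_snd))

end Coordinates

/-! ### Symmetric functions -/

/-- A function on `Xⁿ` is almost everywhere invariant under permutations of its variables. -/
def AESymmetric {n : ℕ} (ν : Measure (Fin n → X)) (F : (Fin n → X) → ℂ) : Prop :=
  ∀ σ : Equiv.Perm (Fin n), (fun k : Fin n → X => F (fun i => k (σ i))) =ᵐ[ν] F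

theorem AESymmetric.congr {n : ℕ} {ν : Measure (Fin n → X)} (hν : PermInvariant ν)
    {F G : (Fin n → X) → ℂ} (hF : AESymmetric ν F) (h : F =ᵐ[ν] G) : AESymmetric ν G := by
  intro σ
  filter_upwards [h, (hν σ).quasiMeasurePreserving.ae h, hF σ] with k h1 h2 h3
  rw [← h2, h3, h1]

/-- Two injective listings of the indices other than `i` differ by a permutation, so a symmetric
function does not see which one is used. -/
theorem exists_perm_succAbove {n : ℕ} (i : Fin (n + 1)) (e : Fin n → Fin (n + 1))
    (he : Function.Injective e) (hi : ∀ l, e l ≠ i) :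
    ∃ τ : Equiv.Perm (Fin n), ∀ l, e l = i.succAbove (τ l) := by
  choose t ht using fun l => Fin.exists_succAbove_eq (hi l)
  have hinj : Function.Injective t := fun l l' h => he (by rw [← ht, ← ht, h])
  exact ⟨Equiv.ofBijective t (Finite.injective_iff_bijective.1 hinj), fun l => (ht l).symm⟩

/-- Serves to move a chosen variable into the last slot, the one that is integrated, with the order
of the others prescribed. -/
theorem exists_perm_snoc {n : ℕ} (i : Fin (n + 1)) (e : Fin n → Fin (n + 1))
    (he : Function.Injective e) (hi : ∀ l, e l ≠ i) :
    ∃ σ : Equiv.Perm (Fin (n + 1)), σ (Fin.last n) = i ∧ ∀ l, σ l.castSucc = e l := by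
  have hinj : Function.Injective (Fin.snoc e i : Fin (n + 1) → Fin (n + 1)) := by
    intro a b
    refine Fin.lastCases ?_ (fun a => ?_) a <;> refine Fin.lastCases ?_ (fun b => ?_) b
    · simp
    · exact fun h => absurd (by simpa using h.symm) (hi b)
    · exact fun h => absurd (by simpa using h) (hi a)
    · simpa using fun h : e a = e b => he h
  exact ⟨Equiv.ofBijective _ (Finite.injective_iff_bijective.1 hinj), by simp, by simp⟩

theorem AESymmetric.comp_eq_removeNth {μ : Measure X} [SigmaFinite μ] {n : ℕ}
    {F : (Fin n → X) → ℂ} (hF : AESymmetric (nMeasure μ n) F) (i : Fin (n + 1))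
    (e : Fin n → Fin (n + 1)) (he : Function.Injective e) (hi : ∀ l, e l ≠ i) :
    ∀ᵐ k ∂nMeasure μ (n + 1), F (fun l => k (e l)) = F (i.removeNth k) := by
  obtain ⟨τ, hτ⟩ := exists_perm_succAbove i e he hi
  filter_upwards [ae_removeNth μ i (hF τ)] with k hk
  rw [← hk]
  simp only [hτ, Fin.removeNth]

/-! ### The annihilation expression -/

theorem enorm_sqrt_succ_sq (n : ℕ) : ‖(Real.sqrt (n + 1) : ℂ)‖ₑ ^ 2 = (n + 1 : ℝ≥0∞) := by
  rw [← ofReal_norm, Complex.norm_real, Real.norm_of_nonneg (Real.sqrt_nonneg _),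
    ← ENNReal.ofReal_pow (Real.sqrt_nonneg _), Real.sq_sqrt (by positivity),
    ENNReal.ofReal_add (by positivity) zero_le_one]
  simp

section Expressions

variable {μ : Measure X} [SigmaFinite μ] {n : ℕ} {a : X → ℝ≥0∞} {f : X → ℂ}
  {Φ Φ' : ∀ n : ℕ, (Fin n → X) → ℂ}

theorem measurable_snoc : Measurable
    (fun p : X × (Fin n → X) => (Fin.snoc p.2 p.1 : Fin (n + 1) → X)) :=
  measurableEmbedding_snoc.measurable

theorem measurable_snoc_right (k : Fin n → X) :
    Measurable (fun x : X => (Fin.snoc k x : Fin (n + 1) → X)) :=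
  measurable_snoc.comp (measurable_id.prodMk measurable_const)

theorem measurable_annihilationFun (hf : Measurable f) (hΦ : Measurable (Φ (n + 1))) :
    Measurable (annihilationFun μ f Φ n) := by
  have h : Measurable (fun p : (Fin n → X) × X => conj (f p.2) * Φ (n + 1) (Fin.snoc p.1 p.2)) :=
    ((Complex.continuous_conj.measurable.comp hf).comp measurable_snd).mul
      (hΦ.comp (measurable_snoc.comp measurable_swap))
  exact (h.stronglyMeasurable.integral_prod_right (ν := μ)).measurable.const_mul _

theorem annihilationFun_congr (h : Φ (n + 1) =ᵐ[nMeasure μ (n + 1)] Φ' (n + 1)) :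
    annihilationFun μ f Φ n =ᵐ[nMeasure μ n] annihilationFun μ f Φ' n := by
  filter_upwards [ae_snoc μ h] with k hk
  unfold annihilationFun
  congr 1
  exact integral_congr_ae (hk.mono fun x hx => by simp only [hx])

theorem aesymmetric_annihilationFun (hs : AESymmetric (nMeasure μ (n + 1)) (Φ (n + 1))) :
    AESymmetric (nMeasure μ n) (annihilationFun μ f Φ n) := by
  intro σ
  -- `τ` extends `σ` to `n + 1` variables and fixes the last one, the integration variable.
  obtain ⟨τ, hl, hτ⟩ := exists_perm_snoc (Fin.last n) (fun l => (σ l).castSucc)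
    (fun a b h => σ.injective (Fin.castSucc_injective _ h)) (fun l => (Fin.castSucc_lt_last _).ne)
  filter_upwards [ae_snoc μ (hs τ)] with k hk
  unfold annihilationFun
  congr 1
  refine integral_congr_ae (hk.mono fun x hx => ?_)
  have e : (fun i => (Fin.snoc k x : Fin (n + 1) → X) (τ i)) =
      (Fin.snoc (fun i => k (σ i)) x : Fin (n + 1) → X) := by
    funext i
    refine Fin.lastCases ?_ (fun l => ?_) i
    · simp [hl]
    · simp [hτ]
  simp only [← hx, e]

theorem lintegral_swap_last {H : (Fin (n + 1) → X) → ℂ} (ha : Measurable a)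
    (hH : Measurable H) (hs : AESymmetric (nMeasure μ (n + 1)) H) (j : Fin (n + 1)) :
    ∫⁻ k, a (k (Fin.last n)) * ‖H k‖ₑ ^ 2 ∂nMeasure μ (n + 1) =
      ∫⁻ k, a (k j) * ‖H k‖ₑ ^ 2 ∂nMeasure μ (n + 1) := by
  have hm : Measurable fun k : Fin (n + 1) → X => a (k (Fin.last n)) * ‖H k‖ₑ ^ 2 :=
    (ha.comp (measurable_pi_apply _)).mul (hH.enorm.pow_const 2)
  rw [← (nMeasure_permInvariant μ (n + 1) (Equiv.swap j (Fin.last n))).lintegral_comp hm]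
  refine lintegral_congr_ae ((hs (Equiv.swap j (Fin.last n))).mono fun k hk => ?_)
  simp only [hk, Equiv.swap_apply_right]

/-- By symmetry each of the `n + 1` summands has the same integral; this is where the factor `n + 1`
of annihilation becomes a second-quantized weight. -/
theorem lintegral_sum_mul_enorm_sq {H : (Fin (n + 1) → X) → ℂ} (ha : Measurable a)
    (hH : Measurable H) (hs : AESymmetric (nMeasure μ (n + 1)) H) :
    ∫⁻ k, (∑ j, a (k j)) * ‖H k‖ₑ ^ 2 ∂nMeasure μ (n + 1) =
      (n + 1) * ∫⁻ k, a (k (Fin.last n)) * ‖H k‖ₑ ^ 2 ∂nMeasure μ (n + 1) := by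
  simp_rw [Finset.sum_mul]
  rw [lintegral_finsetSum]
  · simp_rw [← lintegral_swap_last ha hH hs]
    simp
  · exact fun j _ => (ha.comp (measurable_pi_apply j)).mul (hH.enorm.pow_const 2)

theorem lintegral_annihilationFun_sq_le (ha : Measurable a) (ha0 : ∀ x, a x ≠ 0)
    (hat : ∀ x, a x ≠ ∞) (hf : Measurable f) (hΦ : Measurable (Φ (n + 1)))
    (hs : AESymmetric (nMeasure μ (n + 1)) (Φ (n + 1))) :
    ∫⁻ k, ‖annihilationFun μ f Φ n k‖ₑ ^ 2 ∂nMeasure μ n ≤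
      (∫⁻ x, (a x)⁻¹ * ‖f x‖ₑ ^ 2 ∂μ) *
        ∫⁻ k, (∑ j, a (k j)) * ‖Φ (n + 1) k‖ₑ ^ 2 ∂nMeasure μ (n + 1) := by
  set C := ∫⁻ x, (a x)⁻¹ * ‖f x‖ₑ ^ 2 ∂μ
  have hm : Measurable fun k : Fin (n + 1) → X => a (k (Fin.last n)) * ‖Φ (n + 1) k‖ₑ ^ 2 :=
    (ha.comp (measurable_pi_apply _)).mul (hΦ.enorm.pow_const 2)
  have hb : ∀ k, ‖annihilationFun μ f Φ n k‖ₑ ^ 2 ≤ (n + 1) * C *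
      ∫⁻ x, a x * ‖Φ (n + 1) (Fin.snoc k x)‖ₑ ^ 2 ∂μ := by
    intro k
    rw [annihilationFun, enorm_mul, mul_pow, enorm_sqrt_succ_sq, mul_assoc]
    gcongr
    refine (pow_le_pow_left' (enorm_integral_le_lintegral_enorm _) 2).trans ?_
    simp_rw [enorm_mul, RCLike.enorm_conj]
    exact sq_lintegral_mul_le ha hf.enorm (hΦ.comp (measurable_snoc_right k)).enorm ha0 hat
  have hi : Measurable fun k : Fin n → X => ∫⁻ x, a x * ‖Φ (n + 1) (Fin.snoc k x)‖ₑ ^ 2 ∂μ := by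
    have := (hm.comp measurable_snoc).lintegral_prod_left' (μ := μ)
    simpa using this
  calc _ ≤ ∫⁻ k, (n + 1) * C * ∫⁻ x, a x * ‖Φ (n + 1) (Fin.snoc k x)‖ₑ ^ 2 ∂μ ∂nMeasure μ n :=
        lintegral_mono hb
    _ = (n + 1) * C * ∫⁻ k, a (k (Fin.last n)) * ‖Φ (n + 1) k‖ₑ ^ 2 ∂nMeasure μ (n + 1) := by
      rw [lintegral_const_mul _ hi, lintegral_snoc μ hm]
      simp
    _ = _ := by
      rw [lintegral_sum_mul_enorm_sq ha hΦ hs]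
      ring

/-- Needed for additivity of the annihilation expression, since the Bochner integral of a
non-integrable function is `0` by convention. -/
theorem ae_integrable_annihilation (ha : Measurable a) (ha0 : ∀ x, a x ≠ 0)
    (hat : ∀ x, a x ≠ ∞) (hf : Measurable f) (hΦ : Measurable (Φ (n + 1)))
    (hfin : ∫⁻ x, (a x)⁻¹ * ‖f x‖ₑ ^ 2 ∂μ < ∞)
    (hΦfin : ∫⁻ k, a (k (Fin.last n)) * ‖Φ (n + 1) k‖ₑ ^ 2 ∂nMeasure μ (n + 1) < ∞) :
    ∀ᵐ k ∂nMeasure μ n, Integrable (fun x => conj (f x) * Φ (n + 1) (Fin.snoc k x)) μ := by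
  have hm : Measurable fun k : Fin (n + 1) → X => a (k (Fin.last n)) * ‖Φ (n + 1) k‖ₑ ^ 2 :=
    (ha.comp (measurable_pi_apply _)).mul (hΦ.enorm.pow_const 2)
  have hi : Measurable fun k : Fin n → X => ∫⁻ x, a x * ‖Φ (n + 1) (Fin.snoc k x)‖ₑ ^ 2 ∂μ := by
    have := (hm.comp measurable_snoc).lintegral_prod_left' (μ := μ)
    simpa using this
  rw [lintegral_snoc μ hm] at hΦfin
  simp only [Fin.snoc_last] at hΦfin
  filter_upwards [ae_lt_top hi hΦfin.ne] with k hk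
  have hΦk := hΦ.comp (measurable_snoc_right k)
  refine ⟨((Complex.continuous_conj.measurable.comp hf).mul hΦk).aestronglyMeasurable, ?_⟩
  have h := sq_lintegral_mul_le (ν := μ) ha hf.enorm hΦk.enorm ha0 hat
  have h2 := h.trans_lt (ENNReal.mul_lt_top hfin hk)
  simp only [hasFiniteIntegral_iff_enorm, enorm_mul, RCLike.enorm_conj]
  exact (ENNReal.pow_lt_top_iff.1 h2).resolve_right two_ne_zero

/-! ### The creation expression -/

variable {Ψ Ψ' : ∀ n : ℕ, (Fin n → X) → ℂ}

/-- Putting `kₙ₊₁` in the `j`th slot only reorders the tuple with `kⱼ` removed. The resulting form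
treats all `n + 1` variables alike. -/
theorem creationFun_succ_ae (hs : AESymmetric (nMeasure μ n) (Ψ n)) :
    creationFun f Ψ (n + 1) =ᵐ[nMeasure μ (n + 1)] fun k =>
      (1 / Real.sqrt (n + 1) : ℂ) * ∑ j, Ψ n (j.removeNth k) * f (k j) := by
  have h1 : ∀ j : Fin n, ∀ᵐ k ∂nMeasure μ (n + 1),
      Ψ n (Function.update (Fin.init k) j (k (Fin.last n))) = Ψ n (j.castSucc.removeNth k) := by
    intro j
    -- The updated map lists every index except `j.castSucc`, with the last index standing in slot
    -- `j`.
    have h := hs.comp_eq_removeNth j.castSucc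
      (Function.update Fin.castSucc j (Fin.last n)) ?_ ?_
    · filter_upwards [h] with k hk
      rw [← hk]
      congr 1
      funext l
      by_cases hl : l = j
      · subst hl; simp
      · simp [hl, Fin.init]
    · intro l l' hll
      by_cases hl : l = j <;> by_cases hl' : l' = j
      · rw [hl, hl']
      · subst hl
        simp only [Function.update_self, Function.update_of_ne hl'] at hll
        exact absurd hll.symm (Fin.castSucc_lt_last _).ne
      · subst hl'
        simp only [Function.update_self, Function.update_of_ne hl] at hll
        exact absurd hll (Fin.castSucc_lt_last _).ne
      · simpa [hl, hl'] using hll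
    · intro l
      by_cases hl : l = j
      · subst hl
        simpa using (Fin.castSucc_lt_last l).ne'
      · simpa [hl] using hl
  filter_upwards [ae_all_iff.2 h1] with k hk
  rw [creationFun, Fin.sum_univ_castSucc]
  simp only [hk]
  simp only [Fin.removeNth_last]

theorem creationFun_congr {g : X → ℂ} (hfg : f =ᵐ[μ] g) (hs : AESymmetric (nMeasure μ n) (Ψ n))
    (h : Ψ n =ᵐ[nMeasure μ n] Ψ' n) :
    creationFun f Ψ (n + 1) =ᵐ[nMeasure μ (n + 1)] creationFun g Ψ' (n + 1) := by
  have hs' := hs.congr (nMeasure_permInvariant μ n) h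
  filter_upwards [creationFun_succ_ae hs, creationFun_succ_ae hs',
    ae_all_iff.2 fun j => ae_removeNth μ j h, ae_all_iff.2 fun j => ae_eval μ j hfg]
    with k h1 h2 h3 h4
  rw [h1, h2]
  simp only [h3, h4]

theorem measurable_creationFun_succ (hf : Measurable f) (hΨ : Measurable (Ψ n)) :
    Measurable (creationFun f Ψ (n + 1)) := by
  have hinit : Measurable fun k : Fin (n + 1) → X => (Fin.init k : Fin n → X) :=
    measurable_pi_iff.2 fun i => measurable_pi_apply _
  have hup : ∀ j : Fin n, Measurable fun k : Fin (n + 1) → X =>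
      Function.update (Fin.init k : Fin n → X) j (k (Fin.last n)) := by
    intro j
    refine measurable_pi_iff.2 fun i => ?_
    by_cases hi : i = j
    · subst hi
      simp only [Function.update_self]
      exact measurable_pi_apply _
    · simp only [Function.update_of_ne hi]
      exact measurable_pi_iff.1 hinit i
  refine Measurable.const_mul (Measurable.add ?_ ?_) _
  · exact Finset.measurable_fun_sum _ fun j _ => (hΨ.comp (hup j)).mul
      (hf.comp (measurable_pi_apply _))
  · exact (hΨ.comp hinit).mul (hf.comp (measurable_pi_apply _))

/-- In the form with one variable removed, a permutation of the coordinates merely permutes the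
summands. -/
theorem aesymmetric_creationFun (hs : AESymmetric (nMeasure μ n) (Ψ n)) :
    AESymmetric (nMeasure μ (n + 1)) (creationFun f Ψ (n + 1)) := by
  refine AESymmetric.congr (nMeasure_permInvariant μ _) ?_ (creationFun_succ_ae hs).symm
  intro σ
  have h : ∀ j, ∀ᵐ k ∂nMeasure μ (n + 1),
      Ψ n (j.removeNth fun i => k (σ i)) = Ψ n ((σ j).removeNth k) := fun j =>
    hs.comp_eq_removeNth (σ j) (fun l => σ (j.succAbove l))
      (σ.injective.comp Fin.succAbove_right_injective)
      (fun l h => Fin.succAbove_ne j l (σ.injective h))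
  filter_upwards [ae_all_iff.2 h] with k hk
  simp only [hk]
  rw [Equiv.sum_comp σ fun j => Ψ n (j.removeNth k) * f (k j)]

theorem measurable_removeNth (j : Fin (n + 1)) :
    Measurable fun k : Fin (n + 1) → X => (j.removeNth k : Fin n → X) :=
  measurable_pi_iff.2 fun _ => measurable_pi_apply _

/-- Cauchy–Schwarz over `j` with weights `a(kⱼ)` produces the factor `∑ⱼ a(kⱼ)` that the left-hand
weight cancels. By Tonelli the remaining `n + 1` integrals all equal the right-hand product, and `1
/ (n + 1)` absorbs their number. -/
theorem lintegral_creationFun_sq_le (ha : Measurable a) (ha0 : ∀ x, a x ≠ 0)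
    (hat : ∀ x, a x ≠ ∞) (hf : Measurable f) (hΨ : Measurable (Ψ n))
    (hs : AESymmetric (nMeasure μ n) (Ψ n)) :
    ∫⁻ k, (∑ j, a (k j))⁻¹ * ‖creationFun f Ψ (n + 1) k‖ₑ ^ 2 ∂nMeasure μ (n + 1) ≤
      (∫⁻ x, (a x)⁻¹ * ‖f x‖ₑ ^ 2 ∂μ) * ∫⁻ k, ‖Ψ n k‖ₑ ^ 2 ∂nMeasure μ n := by
  have hc : ‖(1 / Real.sqrt (n + 1) : ℂ)‖ₑ ^ 2 = (n + 1 : ℝ≥0∞)⁻¹ := by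
    rw [one_div, enorm_inv (by
      simpa using (Real.sqrt_pos.2 (by positivity : (0 : ℝ) < n + 1)).ne'), ← ENNReal.inv_pow,
      enorm_sqrt_succ_sq]
  have hb : ∀ᵐ k ∂nMeasure μ (n + 1),
      (∑ j, a (k j))⁻¹ * ‖creationFun f Ψ (n + 1) k‖ₑ ^ 2 ≤
        (n + 1 : ℝ≥0∞)⁻¹ * ∑ j, ((a (k j))⁻¹ * ‖f (k j)‖ₑ ^ 2) * ‖Ψ n (j.removeNth k)‖ₑ ^ 2 := by
    filter_upwards [creationFun_succ_ae hs] with k hk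
    rw [hk, enorm_mul, mul_pow, hc]
    have hS0 : ∑ j, a (k j) ≠ 0 := fun h =>
      ha0 (k 0) (Finset.sum_eq_zero_iff.1 h 0 (Finset.mem_univ _))
    have hSt : ∑ j, a (k j) ≠ ∞ := ENNReal.sum_ne_top.2 fun j _ => hat _
    have h1 : ‖∑ j, Ψ n (j.removeNth k) * f (k j)‖ₑ ^ 2 ≤
        (∑ j, ((a (k j))⁻¹ * ‖f (k j)‖ₑ ^ 2) * ‖Ψ n (j.removeNth k)‖ₑ ^ 2) * ∑ j, a (k j) := by
      refine (pow_le_pow_left' (enorm_sum_le _ _) 2).trans ?_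
      refine (sq_sum_le (fun j => a (k j)) _ (fun j => ha0 _) fun j => hat _).trans_eq ?_
      congr 1
      refine Finset.sum_congr rfl fun j _ => ?_
      rw [enorm_mul]
      ring
    calc _ ≤ (∑ j, a (k j))⁻¹ * ((n + 1 : ℝ≥0∞)⁻¹ *
          ((∑ j, ((a (k j))⁻¹ * ‖f (k j)‖ₑ ^ 2) * ‖Ψ n (j.removeNth k)‖ₑ ^ 2) *
            ∑ j, a (k j))) := by gcongr
      _ = (∑ j, a (k j))⁻¹ * (∑ j, a (k j)) * ((n + 1 : ℝ≥0∞)⁻¹ *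
          (∑ j, ((a (k j))⁻¹ * ‖f (k j)‖ₑ ^ 2) * ‖Ψ n (j.removeNth k)‖ₑ ^ 2)) := by ring
      _ = _ := by rw [ENNReal.inv_mul_cancel hS0 hSt, one_mul]
  have hG : Measurable fun x => (a x)⁻¹ * ‖f x‖ₑ ^ 2 := ha.inv.mul (hf.enorm.pow_const 2)
  have hH : Measurable fun k => ‖Ψ n k‖ₑ ^ 2 := hΨ.enorm.pow_const 2
  have hmj : ∀ j : Fin (n + 1), Measurable fun k : Fin (n + 1) → X =>
      ((a (k j))⁻¹ * ‖f (k j)‖ₑ ^ 2) * ‖Ψ n (j.removeNth k)‖ₑ ^ 2 := fun j =>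
    (hG.comp (measurable_pi_apply j)).mul (hH.comp (measurable_removeNth j))
  refine (lintegral_mono_ae hb).trans_eq ?_
  rw [lintegral_const_mul _ (Finset.measurable_fun_sum _ fun j _ => hmj j),
    lintegral_finsetSum _ fun j _ => hmj j]
  have h2 := fun j => lintegral_mul_removeNth μ j hG hH
  simp only [h2]
  rw [Finset.sum_const, Finset.card_univ, Fintype.card_fin, nsmul_eq_mul, ← mul_assoc]
  push_cast
  rw [ENNReal.inv_mul_cancel (by simp) (by finiteness), one_mul]

/-! ### Duality of the two expressions -/

/-- The `n + 1` summands of the creation expression contribute equally against a symmetric `Φ⁽ⁿ⁺¹⁾`,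
and `(n + 1) / √(n + 1) = √(n + 1)`; Fubini in the last variable then gives annihilation. -/
theorem integral_creation_annihilation (ha : Measurable a) (ha0 : ∀ x, a x ≠ 0)
    (hat : ∀ x, a x ≠ ∞) (hf : Measurable f) (hΨ : Measurable (Ψ n))
    (hΦ : Measurable (Φ (n + 1))) (hsΨ : AESymmetric (nMeasure μ n) (Ψ n))
    (hsΦ : AESymmetric (nMeasure μ (n + 1)) (Φ (n + 1)))
    (hffin : ∫⁻ x, (a x)⁻¹ * ‖f x‖ₑ ^ 2 ∂μ < ∞) (hΨfin : ∫⁻ k, ‖Ψ n k‖ₑ ^ 2 ∂nMeasure μ n < ∞)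
    (hΦfin : ∫⁻ k, a (k (Fin.last n)) * ‖Φ (n + 1) k‖ₑ ^ 2 ∂nMeasure μ (n + 1) < ∞) :
    ∫ k, conj (creationFun f Ψ (n + 1) k) * Φ (n + 1) k ∂nMeasure μ (n + 1) =
      ∫ k, conj (Ψ n k) * annihilationFun μ f Φ n k ∂nMeasure μ n := by
  set F : Fin (n + 1) → (Fin (n + 1) → X) → ℂ := fun j k =>
    conj (Ψ n (j.removeNth k) * f (k j)) * Φ (n + 1) k with hF
  have hmu : ∀ j : Fin (n + 1), Measurable fun k : Fin (n + 1) → X =>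
      Ψ n (j.removeNth k) * f (k j) := fun j =>
    (hΨ.comp (measurable_removeNth j)).mul (hf.comp (measurable_pi_apply j))
  have hmF : ∀ j, Measurable (F j) := fun j =>
    (Complex.continuous_conj.measurable.comp (hmu j)).mul hΦ
  -- Weighted Cauchy–Schwarz with weight `a(kⱼ)`; symmetry of `Φ` reduces its factor to the
  -- hypothesis on the last variable.
  have hint : ∀ j, Integrable (F j) (nMeasure μ (n + 1)) := by
    intro j
    refine ⟨(hmF j).aestronglyMeasurable, ?_⟩
    have h := sq_lintegral_mul_le (ν := nMeasure μ (n + 1))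
      (ha.comp (measurable_pi_apply j)) (hmu j).enorm hΦ.enorm (fun k => ha0 _) (fun k => hat _)
    simp only [Function.comp_apply] at h
    rw [← lintegral_swap_last ha hΦ hsΦ j] at h
    have e : ∫⁻ k, (a (k j))⁻¹ * ‖Ψ n (j.removeNth k) * f (k j)‖ₑ ^ 2 ∂nMeasure μ (n + 1) =
        (∫⁻ x, (a x)⁻¹ * ‖f x‖ₑ ^ 2 ∂μ) * ∫⁻ k, ‖Ψ n k‖ₑ ^ 2 ∂nMeasure μ n := by
      rw [← lintegral_mul_removeNth μ j (G := fun x => (a x)⁻¹ * ‖f x‖ₑ ^ 2)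
        (ha.inv.mul (hf.enorm.pow_const 2)) (hΨ.enorm.pow_const 2)]
      refine lintegral_congr fun k => ?_
      rw [enorm_mul]
      ring
    rw [e] at h
    have h2 := h.trans_lt (ENNReal.mul_lt_top (ENNReal.mul_lt_top hffin hΨfin) hΦfin)
    simp only [hF, hasFiniteIntegral_iff_enorm, enorm_mul, RCLike.enorm_conj] at h2 ⊢
    exact (ENNReal.pow_lt_top_iff.1 h2).resolve_right two_ne_zero
  have hswap : ∀ j, ∫ k, F j k ∂nMeasure μ (n + 1) =
      ∫ k, F (Fin.last n) k ∂nMeasure μ (n + 1) := by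
    intro j
    obtain ⟨σ, hl, hσ⟩ := exists_perm_snoc j j.succAbove Fin.succAbove_right_injective
      (Fin.succAbove_ne j)
    have hemb : MeasurableEmbedding (fun (k : Fin (n + 1) → X) (i : Fin (n + 1)) => k (σ i)) := by
      rw [← coe_piCongrLeft_symm σ]
      exact MeasurableEquiv.measurableEmbedding _
    rw [← (nMeasure_permInvariant μ (n + 1) σ).integral_comp hemb (F (Fin.last n))]
    refine integral_congr_ae (Filter.EventuallyEq.symm <| (hsΦ σ).mono fun k hk => ?_)
    have e : (Fin.last n).removeNth (fun i => k (σ i)) = j.removeNth k := by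
      funext l
      simp [Fin.removeNth, hσ]
    simp only [hF, hk, hl, e]
  have hsqrt : (Real.sqrt (n + 1) : ℂ) ≠ 0 := by
    simpa using (Real.sqrt_pos.2 (by positivity : (0 : ℝ) < n + 1)).ne'
  have hsq : (Real.sqrt (n + 1) : ℂ) * (Real.sqrt (n + 1) : ℂ) = n + 1 := by
    rw [← Complex.ofReal_mul, Real.mul_self_sqrt (by positivity)]
    simp
  calc _ = ∫ k, (1 / Real.sqrt (n + 1) : ℂ) * ∑ j, F j k ∂nMeasure μ (n + 1) := by
        refine integral_congr_ae ((creationFun_succ_ae (f := f) hsΨ).mono fun k hk => ?_)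
        simp only [hk, hF, map_mul, map_sum, map_div₀, map_one, Complex.conj_ofReal,
          Finset.sum_mul, Finset.mul_sum]
        exact Finset.sum_congr rfl fun j _ => by ring
    _ = (1 / Real.sqrt (n + 1) : ℂ) * ((n + 1) * ∫ k, F (Fin.last n) k ∂nMeasure μ (n + 1)) := by
        rw [integral_const_mul, integral_finsetSum _ fun j _ => hint j]
        simp [hswap]
    _ = (Real.sqrt (n + 1) : ℂ) * ∫ k, F (Fin.last n) k ∂nMeasure μ (n + 1) := by
        rw [← hsq]
        field_simp
    _ = _ := by
        rw [integral_snoc μ (hint _), ← integral_const_mul]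
        refine integral_congr_ae (Filter.Eventually.of_forall fun k => ?_)
        simp only [annihilationFun, hF, Fin.removeNth_last, Fin.init_snoc, Fin.snoc_last, map_mul,
          mul_assoc, integral_const_mul]
        ring

end Expressions

/-! ### Norms, elements and operators of symmetric sums -/

theorem enorm_sq_Lp_two {α : Type*} [MeasurableSpace α] {ν : Measure α} (g : Lp ℂ 2 ν) :
    ‖g‖ₑ ^ 2 = ∫⁻ x, ‖g x‖ₑ ^ 2 ∂ν := by
  rw [Lp.enorm_def, eLpNorm_eq_lintegral_rpow_enorm_toReal two_ne_zero ENNReal.ofNat_ne_top,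
    ← ENNReal.rpow_two, ← ENNReal.rpow_mul]
  simp

section SymmetricSum

variable {ν ν' : ∀ n : ℕ, Measure (Fin n → X)} {hν : ∀ n, PermInvariant (ν n)}
  {hν' : ∀ n, PermInvariant (ν' n)}

theorem enorm_sq_symmetricSum (Ψ : symmetricSum ν hν) :
    ‖Ψ‖ₑ ^ 2 = ∑' n, ∫⁻ k, ‖Ψ.1 n k‖ₑ ^ 2 ∂ν n := by
  simp_rw [← enorm_sq_Lp_two]
  have h1 := lp.norm_rpow_eq_tsum (p := 2) (by norm_num) Ψ.1
  have h2 := (lp.memℓp Ψ.1).summable (by norm_num)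
  simp only [ENNReal.toReal_ofNat, Real.rpow_two] at h1 h2
  have h3 : ‖Ψ‖ₑ = ‖Ψ.1‖ₑ := rfl
  rw [h3, ← ofReal_norm, ← ENNReal.ofReal_pow (norm_nonneg _), h1,
    ENNReal.ofReal_tsum_of_nonneg (fun n => by positivity) h2]
  congr 1
  funext n
  rw [ENNReal.ofReal_pow (norm_nonneg _), ofReal_norm]

theorem symmetricSum_ext {Ψ Φ : symmetricSum ν hν} (h : ∀ n, Ψ.1 n =ᵐ[ν n] Φ.1 n) : Ψ = Φ :=
  Subtype.ext (lp.ext (funext fun n => Lp.ext (h n)))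

theorem exists_symmetricSum (F : ∀ n, (Fin n → X) → ℂ)
    (hF : ∀ n, AEStronglyMeasurable (F n) (ν n)) (hs : ∀ n, AESymmetric (ν n) (F n))
    (hfin : ∑' n, ∫⁻ k, ‖F n k‖ₑ ^ 2 ∂ν n < ∞) :
    ∃ Ψ : symmetricSum ν hν, ∀ n, Ψ.1 n =ᵐ[ν n] F n := by
  have hn : ∀ n, ∫⁻ k, ‖F n k‖ₑ ^ 2 ∂ν n < ∞ := fun n => (ENNReal.le_tsum n).trans_lt hfin
  have hL : ∀ n, MemLp (F n) 2 (ν n) := by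
    intro n
    refine ⟨hF n, ?_⟩
    rw [eLpNorm_lt_top_iff_lintegral_rpow_enorm_lt_top two_ne_zero ENNReal.ofNat_ne_top]
    simpa using hn n
  have he : ∀ n, ‖(hL n).toLp (F n)‖ₑ ^ 2 = ∫⁻ k, ‖F n k‖ₑ ^ 2 ∂ν n := by
    intro n
    rw [enorm_sq_Lp_two]
    exact lintegral_congr_ae ((hL n).coeFn_toLp.mono fun k hk => by simp only [hk])
  have hmem : Memℓp (fun n => (hL n).toLp (F n)) 2 := by
    refine memℓp_gen ?_
    have h := ENNReal.summable_toReal hfin.ne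
    refine h.congr fun n => ?_
    rw [← he n, ENNReal.toReal_pow, toReal_enorm]
    simp
  refine ⟨⟨⟨fun n => (hL n).toLp (F n), hmem⟩, fun n => ?_⟩, fun n => (hL n).coeFn_toLp⟩
  exact (hs n).congr (hν n) (hL n).coeFn_toLp.symm

/-- `T` prescribes representatives only; they determine the image classes, so linearity almost
everywhere suffices. -/
theorem exists_continuousLinearMap (T : symmetricSum ν hν → ∀ n, (Fin n → X) → ℂ)
    (hm : ∀ Ψ n, AEStronglyMeasurable (T Ψ n) (ν' n)) (hs : ∀ Ψ n, AESymmetric (ν' n) (T Ψ n))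
    (hadd : ∀ Ψ Φ n, T (Ψ + Φ) n =ᵐ[ν' n] T Ψ n + T Φ n)
    (hsmul : ∀ (c : ℂ) Ψ n, T (c • Ψ) n =ᵐ[ν' n] c • T Ψ n) {C : ℝ} (hC : 0 ≤ C)
    (hb : ∀ Ψ, ∑' n, ∫⁻ k, ‖T Ψ n k‖ₑ ^ 2 ∂ν' n ≤ ENNReal.ofReal C ^ 2 * ‖Ψ‖ₑ ^ 2) :
    ∃ A : symmetricSum ν hν →L[ℂ] symmetricSum ν' hν',
      (∀ Ψ n, (A Ψ).1 n =ᵐ[ν' n] T Ψ n) ∧ ‖A‖ ≤ C := by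
  have hfin : ∀ Ψ, ∑' n, ∫⁻ k, ‖T Ψ n k‖ₑ ^ 2 ∂ν' n < ∞ := fun Ψ =>
    (hb Ψ).trans_lt (by finiteness)
  choose A hA using fun Ψ => exists_symmetricSum (hν := hν') (T Ψ) (hm Ψ) (hs Ψ) (hfin Ψ)
  let L : symmetricSum ν hν →ₗ[ℂ] symmetricSum ν' hν' :=
    { toFun := A
      map_add' := fun Ψ Φ => symmetricSum_ext fun n => by
        have h1 : ((A Ψ + A Φ).1 n : (Fin n → X) → ℂ) =ᵐ[ν' n] (A Ψ).1 n + (A Φ).1 n :=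
          Lp.coeFn_add _ _
        filter_upwards [hA (Ψ + Φ) n, hadd Ψ Φ n, hA Ψ n, hA Φ n, h1] with k h2 h3 h4 h5 h6
        rw [h2, h3, h6, Pi.add_apply, Pi.add_apply, h4, h5]
      map_smul' := fun c Ψ => symmetricSum_ext fun n => by
        have h1 : ((c • A Ψ).1 n : (Fin n → X) → ℂ) =ᵐ[ν' n] c • (A Ψ).1 n :=
          Lp.coeFn_smul _ _
        filter_upwards [hA (c • Ψ) n, hsmul c Ψ n, hA Ψ n, h1] with k h2 h3 h4 h6
        rw [h2, h3, RingHom.id_apply, h6, Pi.smul_apply, Pi.smul_apply, h4] }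
  have hL : ∀ Ψ, ‖L Ψ‖ ≤ C * ‖Ψ‖ := by
    intro Ψ
    have h : ‖L Ψ‖ₑ ^ 2 ≤ (ENNReal.ofReal (C * ‖Ψ‖)) ^ 2 := by
      rw [ENNReal.ofReal_mul hC, mul_pow, ofReal_norm, enorm_sq_symmetricSum]
      refine le_trans (le_of_eq ?_) (hb Ψ)
      congr 1
      funext n
      exact lintegral_congr_ae ((hA Ψ n).mono fun k hk => by simp only [← hk]; rfl)
    rw [← ofReal_norm] at h
    have h2 := (ENNReal.pow_le_pow_left_iff two_ne_zero).1 h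
    exact (ENNReal.ofReal_le_ofReal_iff (by positivity)).1 h2
  exact ⟨L.mkContinuous C hL, hA, L.mkContinuous_norm_le hC hL⟩

theorem inner_symmetricSum (Ψ Φ : symmetricSum ν hν) :
    inner ℂ Ψ Φ = ∑' n, ∫ k, conj (Ψ.1 n k) * Φ.1 n k ∂ν n := by
  rw [Submodule.coe_inner, lp.inner_eq_tsum]
  simp only [L2.inner_def, RCLike.inner_apply']

end SymmetricSum

/-! ### Weights -/

section Weights

variable {μ : Measure X} [SigmaFinite μ] {ω : X → ℝ} {n : ℕ}

theorem weight_pos {Y : Type*} {ω : Y → ℝ} (hpos : ∀ x, 0 < ω x) (k : Fin n → Y) : 0 < weight ω n k :=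
  add_pos_of_nonneg_of_pos (Finset.sum_nonneg fun _ _ => (hpos _).le) one_pos

theorem measurable_weight (hω : Measurable ω) : Measurable (weight ω n) :=
  (Finset.measurable_fun_sum _ fun j _ => hω.comp (measurable_pi_apply j)).add_const 1

theorem measurable_weight_rpow (hω : Measurable ω) (s : ℝ) :
    Measurable fun k => weight ω n k ^ s :=
  (measurable_weight hω).pow_const s

/-- Superadditivity of `t ↦ t^s`: write `t^s = t · t^(s-1)` and bound each `ω(kⱼ)^(s-1)` by the
total weight. This is the only place where `s ≥ 1` itself is needed. -/
theorem sum_ofReal_rpow_le {Y : Type*} {ω : Y → ℝ} (hpos : ∀ x, 0 < ω x) {s : ℝ} (hs : 1 ≤ s)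
    (k : Fin n → Y) :
    ∑ j, ENNReal.ofReal (ω (k j) ^ s) ≤ ENNReal.ofReal (weight ω n k ^ s) := by
  have hw := weight_pos hpos k
  rw [← ENNReal.ofReal_sum_of_nonneg fun j _ => Real.rpow_nonneg (hpos _).le _]
  refine ENNReal.ofReal_le_ofReal ?_
  have hle : ∀ j, ω (k j) ≤ weight ω n k := fun j =>
    (Finset.single_le_sum (f := fun j => ω (k j)) (fun i _ => (hpos _).le)
      (Finset.mem_univ j)).trans (by simp [weight])
  have e : ∀ x : ℝ, 0 < x → x ^ s = x * x ^ (s - 1) := fun x hx => by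
    rw [← Real.rpow_one_add' hx.le (by linarith)]
    congr 1
    ring
  calc ∑ j, ω (k j) ^ s ≤ ∑ j, ω (k j) * weight ω n k ^ (s - 1) := by
        refine Finset.sum_le_sum fun j _ => ?_
        rw [e _ (hpos _)]
        exact mul_le_mul_of_nonneg_left
          (Real.rpow_le_rpow (hpos _).le (hle j) (by linarith)) (hpos _).le
    _ = (∑ j, ω (k j)) * weight ω n k ^ (s - 1) := by rw [Finset.sum_mul]
    _ ≤ weight ω n k * weight ω n k ^ (s - 1) :=
        mul_le_mul_of_nonneg_right (by simp [weight]) (Real.rpow_nonneg hw.le _)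
    _ = _ := (e _ hw).symm

theorem lintegral_scaleMeasure (hω : Measurable ω) (s : ℝ) {F : (Fin n → X) → ℝ≥0∞}
    (hF : Measurable F) :
    ∫⁻ k, F k ∂scaleMeasure μ ω s n =
      ∫⁻ k, ENNReal.ofReal (weight ω n k ^ s) * F k ∂nMeasure μ n :=
  lintegral_withDensity_eq_lintegral_mul _ (measurable_weight_rpow hω s).ennreal_ofReal hF

/-- The density is strictly positive, so null sets agree and almost-everywhere statements pass
freely between the scales. -/
theorem ae_scaleMeasure (hω : Measurable ω) (hpos : ∀ x, 0 < ω x) (s : ℝ) :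
    ae (scaleMeasure μ ω s n) = ae (nMeasure μ n) := by
  refine le_antisymm (withDensity_absolutelyContinuous _ _).ae_le
    (withDensity_absolutelyContinuous' (measurable_weight_rpow hω s).ennreal_ofReal.aemeasurable
      (Filter.Eventually.of_forall fun k => ?_)).ae_le
  simpa using Real.rpow_pos_of_pos (weight_pos hpos k) s

theorem integral_scaleMeasure (hω : Measurable ω) (hpos : ∀ x, 0 < ω x) (s : ℝ)
    (F : (Fin n → X) → ℂ) :
    ∫ k, F k ∂scaleMeasure μ ω s n =
      ∫ k, ((weight ω n k ^ s : ℝ) : ℂ) * F k ∂nMeasure μ n := by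
  rw [scaleMeasure, integral_withDensity_eq_integral_toReal_smul
    (measurable_weight_rpow hω s).ennreal_ofReal
    (Filter.Eventually.of_forall fun k => ENNReal.ofReal_lt_top)]
  refine integral_congr_ae (Filter.Eventually.of_forall fun k => ?_)
  simp only [ENNReal.toReal_ofReal (Real.rpow_nonneg (weight_pos hpos k).le s),
    Complex.real_smul]

theorem ofReal_rpow_neg {x : ℝ} (hx : 0 < x) (s : ℝ) :
    ENNReal.ofReal (x ^ (-s)) = (ENNReal.ofReal (x ^ s))⁻¹ := by
  rw [Real.rpow_neg hx.le, ENNReal.ofReal_inv_of_pos (Real.rpow_pos_of_pos hx s)]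

theorem enorm_sq_oneParticle {μ : Measure X} (hω : Measurable ω) (hpos : ∀ x, 0 < ω x) {s : ℝ}
    (f : OneParticleScale μ ω (-s)) :
    ‖f‖ₑ ^ 2 = ∫⁻ x, (ENNReal.ofReal (ω x ^ s))⁻¹ * ‖f x‖ₑ ^ 2 ∂μ := by
  rw [enorm_sq_Lp_two, lintegral_withDensity_eq_lintegral_mul _
    (hω.pow_const (-s)).ennreal_ofReal ((Lp.stronglyMeasurable f).measurable.enorm.pow_const 2)]
  refine lintegral_congr fun x => ?_
  rw [Pi.mul_apply, ofReal_rpow_neg (hpos x)]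

/-! ### The duality pairing -/

/-- With `w` the weight, `Θ = w^(-s) Ψ` works: `w^s |w^(-s) Ψ|² = w^(-s) |Ψ|²` puts it in `𝓕₊ₛ`, and
both integrands reduce to `conj Ψ · Φ`. -/
theorem exists_pairing_eq_inner (hω : Measurable ω) (hpos : ∀ x, 0 < ω x) {s : ℝ}
    (Ψ : FockScale μ ω (-s)) :
    ∃ Θ : FockScale μ ω s,
      (∀ n, Θ.toFun n =ᵐ[nMeasure μ n] fun k => ((weight ω n k ^ (-s) : ℝ) : ℂ) * Ψ.toFun n k) ∧
      ∀ Φ : FockScale μ ω s, pairing Ψ Φ = inner ℂ Θ Φ := by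
  have hm : ∀ n, Measurable (Ψ.toFun n) := fun n => (Lp.stronglyMeasurable _).measurable
  have hmw : ∀ n, Measurable fun k => ((weight ω n k ^ (-s) : ℝ) : ℂ) * Ψ.toFun n k := fun n =>
    (Complex.measurable_ofReal.comp (measurable_weight_rpow hω (-s))).mul (hm n)
  have hsym : ∀ n, AESymmetric (scaleMeasure μ ω s n)
      fun k => ((weight ω n k ^ (-s) : ℝ) : ℂ) * Ψ.toFun n k := by
    intro n σ
    have h := Ψ.2 n σ
    rw [Filter.EventuallyEq, ae_scaleMeasure hω hpos] at h ⊢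
    filter_upwards [h] with k hk
    have hw : weight ω n (fun i => k (σ i)) = weight ω n k := by
      simp only [weight, Equiv.sum_comp σ (fun i => ω (k i))]
    rw [hw]
    congr 1
  have hfin : ∑' n, ∫⁻ k, ‖((weight ω n k ^ (-s) : ℝ) : ℂ) * Ψ.toFun n k‖ₑ ^ 2
      ∂scaleMeasure μ ω s n < ∞ := by
    have h : ‖Ψ‖ₑ ^ 2 < ∞ := by finiteness
    rw [enorm_sq_symmetricSum] at h
    convert h using 3 with n
    rw [lintegral_scaleMeasure hω s ((hmw n).enorm.pow_const 2),
      lintegral_scaleMeasure hω (-s) (F := fun k => ‖Ψ.1 n k‖ₑ ^ 2) ((hm n).enorm.pow_const 2)]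
    refine lintegral_congr fun k => ?_
    have hw := weight_pos hpos k
    have hw' := Real.rpow_pos_of_pos hw s
    rw [enorm_mul, mul_pow, ← mul_assoc, ← ofReal_norm, Complex.norm_real,
      Real.norm_of_nonneg (Real.rpow_nonneg hw.le _), ← ENNReal.ofReal_pow
      (Real.rpow_nonneg hw.le _), ← ENNReal.ofReal_mul hw'.le]
    congr 2
    rw [Real.rpow_neg hw.le]
    field_simp
  obtain ⟨Θ, hΘ⟩ : ∃ Θ : FockScale μ ω s, ∀ n, Θ.toFun n =ᵐ[scaleMeasure μ ω s n]
      fun k => ((weight ω n k ^ (-s) : ℝ) : ℂ) * Ψ.toFun n k := exists_symmetricSum _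
    (fun n => (hmw n).aestronglyMeasurable) hsym hfin
  have hΘ' : ∀ n, Θ.toFun n =ᵐ[nMeasure μ n]
      fun k => ((weight ω n k ^ (-s) : ℝ) : ℂ) * Ψ.toFun n k := by
    intro n
    have h := hΘ n
    rwa [Filter.EventuallyEq, ae_scaleMeasure hω hpos] at h
  refine ⟨Θ, hΘ', fun Φ => ?_⟩
  rw [inner_symmetricSum, pairing]
  congr 1
  funext n
  rw [integral_scaleMeasure hω hpos]
  refine integral_congr_ae ((hΘ' n).mono fun k hk => ?_)
  have hw := weight_pos hpos k
  change _ = _ * (conj (Θ.toFun n k) * Φ.toFun n k)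
  have e1 : weight ω n k ^ s * weight ω n k ^ (-s) = 1 := by
    rw [← Real.rpow_add hw]; simp
  have e2 : weight ω n k ^ (-s / 2) * weight ω n k ^ (s / 2) = 1 := by
    rw [← Real.rpow_add hw]; ring_nf; simp
  simp only [hk, map_mul, Complex.conj_ofReal]
  calc _ = ((weight ω n k ^ (-s / 2) * weight ω n k ^ (s / 2) : ℝ) : ℂ) *
        (conj (Ψ.toFun n k) * Φ.toFun n k) := by push_cast; ring
    _ = ((weight ω n k ^ s * weight ω n k ^ (-s) : ℝ) : ℂ) *
        (conj (Ψ.toFun n k) * Φ.toFun n k) := by rw [e1, e2]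
    _ = _ := by push_cast; ring

theorem eq_of_pairing_eq (hω : Measurable ω) (hpos : ∀ x, 0 < ω x) {s : ℝ}
    {Ψ Ψ' : FockScale μ ω (-s)} (h : ∀ Φ : FockScale μ ω s, pairing Ψ Φ = pairing Ψ' Φ) :
    Ψ = Ψ' := by
  obtain ⟨Θ, h1, h2⟩ := exists_pairing_eq_inner hω hpos Ψ
  obtain ⟨Θ', h1', h2'⟩ := exists_pairing_eq_inner hω hpos Ψ'
  have e : Θ = Θ' := ext_inner_right ℂ fun Φ => by rw [← h2, ← h2', h]
  refine symmetricSum_ext fun n => ?_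
  rw [Filter.EventuallyEq, ae_scaleMeasure hω hpos]
  filter_upwards [h1 n, h1' n] with k hk hk'
  rw [← e, hk] at hk'
  refine mul_left_cancel₀ ?_ hk'
  exact_mod_cast (Real.rpow_pos_of_pos (weight_pos hpos k) _).ne'

end Weights

/-! ### The singular operators -/

section Operators

variable {μ : Measure X} [SigmaFinite μ] {ω : X → ℝ} {n : ℕ}

theorem FockScale.measurable_toFun {s : ℝ} (Φ : FockScale μ ω s) (n : ℕ) :
    Measurable (Φ.toFun n) :=
  (Lp.stronglyMeasurable _).measurable

theorem Fock.measurable_toFun (Ψ : Fock μ) (n : ℕ) : Measurable (Ψ.toFun n) :=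
  (Lp.stronglyMeasurable _).measurable

theorem Fock.aesymmetric (Ψ : Fock μ) (n : ℕ) : AESymmetric (nMeasure μ n) (Ψ.toFun n) :=
  Ψ.2 n

theorem FockScale.aesymmetric (hω : Measurable ω) (hpos : ∀ x, 0 < ω x) {s : ℝ}
    (Φ : FockScale μ ω s) (n : ℕ) : AESymmetric (nMeasure μ n) (Φ.toFun n) := by
  intro σ
  have h := Φ.2 n σ
  rwa [Filter.EventuallyEq, ae_scaleMeasure hω hpos] at h

theorem Fock.enorm_sq (Ψ : Fock μ) :
    ‖Ψ‖ₑ ^ 2 = ∑' n, ∫⁻ k, ‖Ψ.toFun n k‖ₑ ^ 2 ∂nMeasure μ n :=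
  enorm_sq_symmetricSum Ψ

theorem FockScale.enorm_sq (hω : Measurable ω) {s : ℝ} (Φ : FockScale μ ω s) :
    ‖Φ‖ₑ ^ 2 = ∑' n, ∫⁻ k, ENNReal.ofReal (weight ω n k ^ s) * ‖Φ.toFun n k‖ₑ ^ 2
      ∂nMeasure μ n := by
  rw [enorm_sq_symmetricSum]
  congr 1
  funext n
  exact lintegral_scaleMeasure hω s ((Φ.measurable_toFun n).enorm.pow_const 2)

theorem FockScale.lintegral_sum_mul_le (hpos : ∀ x, 0 < ω x) {s : ℝ} (hs : 1 ≤ s)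
    (Φ : FockScale μ ω s) (n : ℕ) :
    ∫⁻ k, (∑ j, ENNReal.ofReal (ω (k j) ^ s)) * ‖Φ.toFun n k‖ₑ ^ 2 ∂nMeasure μ n ≤
      ∫⁻ k, ENNReal.ofReal (weight ω n k ^ s) * ‖Φ.toFun n k‖ₑ ^ 2 ∂nMeasure μ n :=
  lintegral_mono fun k => by gcongr; exact sum_ofReal_rpow_le hpos hs k

theorem FockScale.lintegral_last_mul_lt_top (hω : Measurable ω) (hpos : ∀ x, 0 < ω x) {s : ℝ}
    (hs : 1 ≤ s) (Φ : FockScale μ ω s) (n : ℕ) :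
    ∫⁻ k, ENNReal.ofReal (ω (k (Fin.last n)) ^ s) * ‖Φ.toFun (n + 1) k‖ₑ ^ 2
      ∂nMeasure μ (n + 1) < ∞ := by
  have h : ‖Φ‖ₑ ^ 2 < ∞ := by finiteness
  rw [Φ.enorm_sq hω] at h
  refine lt_of_le_of_lt ?_ (((Φ.lintegral_sum_mul_le hpos hs (n + 1)).trans
    (ENNReal.le_tsum (n + 1))).trans_lt h)
  refine lintegral_mono fun k => ?_
  gcongr
  exact Finset.single_le_sum (f := fun j => ENNReal.ofReal (ω (k j) ^ s)) (fun _ _ => zero_le)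
    (Finset.mem_univ (Fin.last n))

theorem FockScale.coeFn_add (hω : Measurable ω) (hpos : ∀ x, 0 < ω x) {s : ℝ}
    (Φ Φ' : FockScale μ ω s) (n : ℕ) :
    FockScale.toFun (Φ + Φ') n =ᵐ[nMeasure μ n] Φ.toFun n + Φ'.toFun n := by
  have h : FockScale.toFun (Φ + Φ') n =ᵐ[scaleMeasure μ ω s n] Φ.toFun n + Φ'.toFun n :=
    Lp.coeFn_add _ _
  rwa [Filter.EventuallyEq, ae_scaleMeasure hω hpos] at h

theorem FockScale.coeFn_smul (hω : Measurable ω) (hpos : ∀ x, 0 < ω x) {s : ℝ} (c : ℂ)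
    (Φ : FockScale μ ω s) (n : ℕ) :
    FockScale.toFun (c • Φ) n =ᵐ[nMeasure μ n] c • Φ.toFun n := by
  have h : FockScale.toFun (c • Φ) n =ᵐ[scaleMeasure μ ω s n] c • Φ.toFun n :=
    Lp.coeFn_smul _ _
  rwa [Filter.EventuallyEq, ae_scaleMeasure hω hpos] at h

theorem Fock.coeFn_add (Ψ Ψ' : Fock μ) (n : ℕ) :
    Fock.toFun (Ψ + Ψ') n =ᵐ[nMeasure μ n] Ψ.toFun n + Ψ'.toFun n :=
  Lp.coeFn_add _ _

theorem Fock.coeFn_smul (c : ℂ) (Ψ : Fock μ) (n : ℕ) :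
    Fock.toFun (c • Ψ) n =ᵐ[nMeasure μ n] c • Ψ.toFun n :=
  Lp.coeFn_smul _ _

theorem measurable_oneParticle {μ : Measure X} {s : ℝ} (f : OneParticleScale μ ω s) : Measurable f :=
  (Lp.stronglyMeasurable f).measurable

theorem ofReal_norm_sq {E : Type*} [SeminormedAddCommGroup E] (x : E) :
    ENNReal.ofReal ‖x‖ ^ 2 = ‖x‖ₑ ^ 2 := by
  rw [ofReal_norm]

theorem exists_isSingularAnnihilation (hω : Measurable ω) (hpos : ∀ x, 0 < ω x) {s : ℝ}
    (hs : 1 ≤ s) (f : OneParticleScale μ ω (-s)) :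
    ∃ A : FockScale μ ω s →L[ℂ] Fock μ, IsSingularAnnihilation f A := by
  have ha : Measurable fun x => ENNReal.ofReal (ω x ^ s) := (hω.pow_const s).ennreal_ofReal
  have ha0 : ∀ x, ENNReal.ofReal (ω x ^ s) ≠ 0 := fun x => by
    simpa using Real.rpow_pos_of_pos (hpos x) s
  have hat : ∀ x, ENNReal.ofReal (ω x ^ s) ≠ ∞ := fun x => ENNReal.ofReal_ne_top
  have hf := measurable_oneParticle f
  have hffin : ∫⁻ x, (ENNReal.ofReal (ω x ^ s))⁻¹ * ‖f x‖ₑ ^ 2 ∂μ < ∞ := by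
    rw [← enorm_sq_oneParticle hω hpos]
    finiteness
  have hint := fun (Φ : FockScale μ ω s) n => ae_integrable_annihilation (Φ := Φ.toFun) ha ha0 hat
    hf (Φ.measurable_toFun (n + 1)) hffin (Φ.lintegral_last_mul_lt_top hω hpos hs n)
  suffices h : ∃ A : FockScale μ ω s →L[ℂ] Fock μ, (∀ Φ n, (A Φ).1 n =ᵐ[nMeasure μ n]
      annihilationFun μ f (FockScale.toFun Φ) n) ∧ ‖A‖ ≤ ‖f‖ from h.imp fun A hA => hA.1
  refine exists_continuousLinearMap (hν := scaleMeasure_permInvariant μ ω s)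
    (hν' := nMeasure_permInvariant μ)
    (fun Φ => annihilationFun μ f (FockScale.toFun Φ))
    (fun Φ n => (measurable_annihilationFun hf
      (FockScale.measurable_toFun Φ (n + 1))).aestronglyMeasurable)
    (fun Φ n => aesymmetric_annihilationFun (FockScale.aesymmetric hω hpos Φ (n + 1)))
    ?_ ?_ (norm_nonneg f) ?_
  · intro Φ Φ' n
    refine (annihilationFun_congr (Φ' := fun n => FockScale.toFun Φ n + FockScale.toFun Φ' n)
      (FockScale.coeFn_add hω hpos Φ Φ' (n + 1))).trans ?_
    filter_upwards [hint Φ n, hint Φ' n] with k h1 h2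
    simp only [annihilationFun, Pi.add_apply, mul_add]
    rw [integral_add h1 h2, mul_add]
  · intro c Φ n
    refine (annihilationFun_congr (Φ' := fun n => c • FockScale.toFun Φ n)
      (FockScale.coeFn_smul hω hpos c Φ (n + 1))).trans (Filter.Eventually.of_forall fun k => ?_)
    simp only [annihilationFun, Pi.smul_apply, smul_eq_mul, mul_left_comm _ c, integral_const_mul]
  · intro Φ
    rw [ofReal_norm_sq, enorm_sq_oneParticle hω hpos, FockScale.enorm_sq hω Φ,
      ← ENNReal.tsum_mul_left]
    -- Component `n` of the image is bounded by component `n + 1` of `Φ`; the vacuum term of `‖Φ‖²`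
    -- is dropped.
    refine le_trans (ENNReal.tsum_le_tsum fun n => ?_)
      (ENNReal.tsum_comp_le_tsum_of_injective (add_left_injective 1) _)
    refine (lintegral_annihilationFun_sq_le ha ha0 hat hf (FockScale.measurable_toFun Φ (n + 1))
      (FockScale.aesymmetric hω hpos Φ (n + 1))).trans ?_
    gcongr _ * ?_
    exact FockScale.lintegral_sum_mul_le hpos hs Φ (n + 1)

theorem creationFun_zero {Y : Type*} (f : Y → ℂ) (Ψ : ∀ n : ℕ, (Fin n → Y) → ℂ) (k : Fin 0 → Y) :
    creationFun f Ψ 0 k = 0 := rfl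

theorem creationFun_add {Y : Type*} (f : Y → ℂ) (Ψ Ψ' : ∀ n : ℕ, (Fin n → Y) → ℂ) (n : ℕ) :
    creationFun f (fun n => Ψ n + Ψ' n) n = creationFun f Ψ n + creationFun f Ψ' n := by
  funext k
  cases n with
  | zero => simp [creationFun]
  | succ n =>
    simp only [creationFun, Pi.add_apply, add_mul, Finset.sum_add_distrib]
    ring

theorem creationFun_smul {Y : Type*} (f : Y → ℂ) (c : ℂ) (Ψ : ∀ n : ℕ, (Fin n → Y) → ℂ) (n : ℕ) :
    creationFun f (fun n => c • Ψ n) n = c • creationFun f Ψ n := by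
  funext k
  cases n with
  | zero => simp [creationFun]
  | succ n =>
    simp only [creationFun, Pi.smul_apply, smul_eq_mul, mul_assoc, ← Finset.mul_sum]
    ring

theorem creationFun_congr_ae {f g : X → ℂ} (hfg : f =ᵐ[μ] g)
    {Ψ Ψ' : ∀ n : ℕ, (Fin n → X) → ℂ} (hs : ∀ n, AESymmetric (nMeasure μ n) (Ψ n))
    (h : ∀ n, Ψ n =ᵐ[nMeasure μ n] Ψ' n) (n : ℕ) :
    creationFun f Ψ n =ᵐ[nMeasure μ n] creationFun g Ψ' n := by
  cases n with
  | zero => exact Filter.EventuallyEq.rfl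
  | succ n => exact creationFun_congr hfg (hs n) (h n)

theorem measurable_creationFun {f : X → ℂ} (hf : Measurable f) (Ψ : Fock μ) (n : ℕ) :
    Measurable (creationFun f Ψ.toFun n) := by
  cases n with
  | zero => exact measurable_const
  | succ n => exact measurable_creationFun_succ hf (Ψ.measurable_toFun n)

theorem Fock.aesymmetric_creationFun (f : X → ℂ) (Ψ : Fock μ) (n : ℕ) :
    AESymmetric (nMeasure μ n) (creationFun f Ψ.toFun n) := by
  cases n with
  | zero => exact fun σ => Filter.EventuallyEq.rfl
  | succ n => exact SingularFock.aesymmetric_creationFun (Ψ.aesymmetric n)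

theorem exists_singularCreation (hω : Measurable ω) (hpos : ∀ x, 0 < ω x) {s : ℝ}
    (hs : 1 ≤ s) (f : OneParticleScale μ ω (-s)) :
    ∃ B : Fock μ →L[ℂ] FockScale μ ω (-s),
      (∀ Ψ n, (B Ψ).toFun n =ᵐ[nMeasure μ n] creationFun f Ψ.toFun n) ∧ ‖B‖ ≤ ‖f‖ := by
  have ha : Measurable fun x => ENNReal.ofReal (ω x ^ s) := (hω.pow_const s).ennreal_ofReal
  have ha0 : ∀ x, ENNReal.ofReal (ω x ^ s) ≠ 0 := fun x => by
    simpa using Real.rpow_pos_of_pos (hpos x) s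
  have hat : ∀ x, ENNReal.ofReal (ω x ^ s) ≠ ∞ := fun x => ENNReal.ofReal_ne_top
  have hf := measurable_oneParticle f
  have hae := fun n => ae_scaleMeasure (μ := μ) (n := n) hω hpos (-s)
  suffices h : ∃ B : Fock μ →L[ℂ] FockScale μ ω (-s),
      (∀ Ψ n, (B Ψ).1 n =ᵐ[scaleMeasure μ ω (-s) n] creationFun f (Fock.toFun Ψ) n) ∧
        ‖B‖ ≤ ‖f‖ by
    obtain ⟨B, hB, hBf⟩ := h
    refine ⟨B, fun Ψ n => ?_, hBf⟩
    have h := hB Ψ n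
    rwa [Filter.EventuallyEq, hae] at h
  refine exists_continuousLinearMap (hν := nMeasure_permInvariant μ)
    (hν' := scaleMeasure_permInvariant μ ω (-s))
    (fun Ψ => creationFun f (Fock.toFun Ψ))
    (fun Ψ n => (measurable_creationFun hf Ψ n).aestronglyMeasurable)
    ?_ ?_ ?_ (norm_nonneg f) ?_
  · intro Ψ n σ
    rw [Filter.EventuallyEq, hae]
    exact Fock.aesymmetric_creationFun f Ψ n σ
  · intro Ψ Ψ' n
    rw [Filter.EventuallyEq, hae, ← creationFun_add]
    exact creationFun_congr_ae Filter.EventuallyEq.rfl (Fock.aesymmetric _) (Fock.coeFn_add Ψ Ψ') n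
  · intro c Ψ n
    rw [Filter.EventuallyEq, hae, ← creationFun_smul]
    exact creationFun_congr_ae Filter.EventuallyEq.rfl (Fock.aesymmetric _) (Fock.coeFn_smul c Ψ) n
  · intro Ψ
    rw [ofReal_norm_sq, enorm_sq_oneParticle hω hpos, Fock.enorm_sq Ψ, ← ENNReal.tsum_mul_left,
      tsum_eq_zero_add' ENNReal.summable]
    simp only [creationFun_zero, enorm_zero, ne_eq, OfNat.ofNat_ne_zero, not_false_eq_true, zero_pow,
      lintegral_zero, zero_add]
    refine ENNReal.tsum_le_tsum fun n => ?_
    refine le_trans ?_ (lintegral_creationFun_sq_le ha ha0 hat hf (Fock.measurable_toFun Ψ n)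
      (Fock.aesymmetric Ψ n))
    rw [lintegral_scaleMeasure hω (-s) ((measurable_creationFun hf Ψ (n + 1)).enorm.pow_const 2)]
    refine lintegral_mono fun k => ?_
    -- Inversion reverses `∑ⱼ ω(kⱼ)^s ≤ (∑ⱼ ω(kⱼ) + 1)^s`.
    rw [ofReal_rpow_neg (weight_pos hpos k)]
    gcongr
    exact sum_ofReal_rpow_le hpos hs k

theorem isPairingAdjoint_of_creationFun (hω : Measurable ω) (hpos : ∀ x, 0 < ω x) {s : ℝ}
    (hs : 1 ≤ s) {f : OneParticleScale μ ω (-s)} {A : FockScale μ ω s →L[ℂ] Fock μ}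
    (hA : IsSingularAnnihilation f A) {B : Fock μ →L[ℂ] FockScale μ ω (-s)}
    (hB : ∀ Ψ n, (B Ψ).toFun n =ᵐ[nMeasure μ n] creationFun f Ψ.toFun n) :
    IsPairingAdjoint A B := by
  intro Φ Ψ
  have hf := measurable_oneParticle f
  have h1 : inner ℂ Ψ (A Φ) =
      ∑' n, ∫ k, conj (Ψ.toFun n k) * annihilationFun μ f Φ.toFun n k ∂nMeasure μ n := by
    rw [inner_symmetricSum]
    congr 1
    funext n
    refine integral_congr_ae ((hA Φ n).mono fun k hk => ?_)
    simp only [← hk]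
    rfl
  have h2 : pairing (B Ψ) Φ =
      ∑' n, ∫ k, conj (creationFun f Ψ.toFun n k) * Φ.toFun n k ∂nMeasure μ n := by
    rw [pairing]
    congr 1
    funext n
    refine integral_congr_ae ((hB Ψ n).mono fun k hk => ?_)
    have e : weight ω n k ^ (-s / 2) * weight ω n k ^ (s / 2) = 1 := by
      rw [← Real.rpow_add (weight_pos hpos k)]; ring_nf; simp
    simp only [hk, map_mul, Complex.conj_ofReal]
    calc _ = ((weight ω n k ^ (-s / 2) * weight ω n k ^ (s / 2) : ℝ) : ℂ) *
          (conj (creationFun f Ψ.toFun n k) * Φ.toFun n k) := by push_cast; ring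
      _ = _ := by rw [e, Complex.ofReal_one, one_mul]
  -- The vacuum component of the creation expression vanishes, so the pairing series may be
  -- reindexed over `n + 1`.
  rw [h1, h2, ← (add_left_injective 1).tsum_eq (g := fun n : ℕ => n + 1)
    (f := fun n => ∫ k, conj (creationFun f Ψ.toFun n k) * Φ.toFun n k ∂nMeasure μ n)]
  · congr 1
    funext n
    refine (integral_creation_annihilation (hω.pow_const s).ennreal_ofReal
      (fun x => ?_) (fun x => ENNReal.ofReal_ne_top) hf (Ψ.measurable_toFun n)
      (Φ.measurable_toFun (n + 1)) (Ψ.aesymmetric n) (Φ.aesymmetric hω hpos (n + 1)) ?_ ?_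
      (Φ.lintegral_last_mul_lt_top hω hpos hs n)).symm
    · simpa using Real.rpow_pos_of_pos (hpos x) s
    · rw [← enorm_sq_oneParticle hω hpos]
      finiteness
    · have h : ‖Ψ‖ₑ ^ 2 < ∞ := by finiteness
      rw [Ψ.enorm_sq] at h
      exact (ENNReal.le_tsum n).trans_lt h
  · intro n hn
    cases n with
    | zero => simp [creationFun] at hn
    | succ n => exact ⟨n, rfl⟩

/-! ### The regular creation operator -/

/-- Here the lower bound `m`, not just positivity of `ω`, matters: `∑ⱼ ω(kⱼ) + 1 ≥ nm + 1`, and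
`(m⁻¹ + 1)(nm + 1) ≥ n + 1`. -/
theorem tsum_number_lt_top (hω : Measurable ω) {m : ℝ} (hm : 0 < m) (hmω : ∀ x, m ≤ ω x)
    {Ψ : Fock μ} (hΨ : MemScale ω 1 Ψ) :
    ∑' n : ℕ, (n + 1 : ℝ≥0∞) * ∫⁻ k, ‖Ψ.toFun n k‖ₑ ^ 2 ∂nMeasure μ n < ∞ := by
  obtain ⟨Φ, hΦ⟩ := hΨ
  have hb : ∀ (n : ℕ) (k : Fin n → X),
      (n + 1 : ℝ≥0∞) ≤ ENNReal.ofReal (m⁻¹ + 1) * ENNReal.ofReal (weight ω n k ^ (1 : ℝ)) := by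
    intro n k
    rw [← ENNReal.ofReal_mul (by positivity), Real.rpow_one]
    have e : (n + 1 : ℝ≥0∞) = ENNReal.ofReal (n + 1) := by
      rw [ENNReal.ofReal_add (by positivity) zero_le_one]; simp
    rw [e]
    refine ENNReal.ofReal_le_ofReal ?_
    have h : n * m + 1 ≤ weight ω n k := by
      have := Finset.card_nsmul_le_sum Finset.univ (fun j => ω (k j)) m fun j _ => hmω _
      simp only [Finset.card_univ, Fintype.card_fin, nsmul_eq_mul] at this
      simpa [weight] using this
    calc (n + 1 : ℝ) ≤ (m⁻¹ + 1) * (n * m + 1) := by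
          have : m⁻¹ * (n * m) = n := by field_simp
          have h2 : 0 ≤ (n : ℝ) * m := by positivity
          have h3 : 0 < m⁻¹ := by positivity
          nlinarith
      _ ≤ _ := by gcongr
  have hfin : ‖Φ‖ₑ ^ 2 < ∞ := by finiteness
  refine lt_of_le_of_lt ?_ (ENNReal.mul_lt_top (ENNReal.ofReal_lt_top (r := m⁻¹ + 1)) hfin)
  rw [Φ.enorm_sq hω, ← ENNReal.tsum_mul_left]
  refine ENNReal.tsum_le_tsum fun n => ?_
  rw [← lintegral_const_mul _ ((Ψ.measurable_toFun n).enorm.pow_const 2),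
    ← lintegral_const_mul (ENNReal.ofReal (m⁻¹ + 1))
      (f := fun k => ENNReal.ofReal (weight ω n k ^ (1 : ℝ)) * ‖Φ.toFun n k‖ₑ ^ 2)
      ((measurable_weight_rpow hω 1).ennreal_ofReal.mul
        ((Φ.measurable_toFun n).enorm.pow_const 2))]
  refine lintegral_mono_ae ((hΦ n).mono fun k hk => ?_)
  rw [hk, ← mul_assoc]
  gcongr
  exact hb n k

theorem exists_isRegularCreation (hω : Measurable ω) {m : ℝ} (hm : 0 < m)
    (hmω : ∀ x, m ≤ ω x) (g : Lp ℂ 2 μ) {Ψ : Fock μ} (hΨ : MemScale ω 1 Ψ) :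
    ∃ Ξ : Fock μ, IsRegularCreation g Ψ Ξ := by
  have hN := tsum_number_lt_top hω hm hmω hΨ
  have hg : Measurable g := (Lp.stronglyMeasurable g).measurable
  have hgfin : ‖g‖ₑ ^ 2 < ∞ := by finiteness
  have hg1 : ∫⁻ x, (1 : ℝ≥0∞)⁻¹ * ‖g x‖ₑ ^ 2 ∂μ = ‖g‖ₑ ^ 2 := by
    simp [enorm_sq_Lp_two]
  have hdom : Ψ ∈ regularDomain g := by
    refine lt_of_le_of_lt ?_ (ENNReal.mul_lt_top hgfin hN)
    rw [← ENNReal.tsum_mul_left]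
    have hinj : Function.Injective fun n : ℕ => n + 1 := add_left_injective 1
    -- With `a = 1` the weight on component `n + 1` is `n + 1`, the shift of `n ↦ n`; afterwards `n
    -- ≤ n + 1`.
    refine le_trans (ENNReal.tsum_le_tsum fun n => ?_)
      ((ENNReal.tsum_comp_le_tsum_of_injective hinj fun n =>
        ‖g‖ₑ ^ 2 * (n * ∫⁻ k, ‖Ψ.toFun n k‖ₑ ^ 2 ∂nMeasure μ n)).trans
        (ENNReal.tsum_le_tsum fun n => by gcongr; exact le_self_add))
    refine (lintegral_annihilationFun_sq_le (a := fun _ => 1) measurable_const (by simp) (by simp)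
      hg (Ψ.measurable_toFun (n + 1)) (Ψ.aesymmetric (n + 1))).trans_eq ?_
    rw [hg1, lintegral_const_mul _ ((Ψ.measurable_toFun (n + 1)).enorm.pow_const 2)]
    simp
  obtain ⟨Ξ, hΞ⟩ : ∃ Ξ : Fock μ, ∀ n, Ξ.toFun n =ᵐ[nMeasure μ n] creationFun g Ψ.toFun n := by
    refine exists_symmetricSum _ (fun n => (measurable_creationFun hg Ψ n).aestronglyMeasurable)
      (Fock.aesymmetric_creationFun g Ψ) ?_
    refine lt_of_le_of_lt ?_ (ENNReal.mul_lt_top hgfin hN)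
    rw [← ENNReal.tsum_mul_left, tsum_eq_zero_add' ENNReal.summable]
    simp only [creationFun_zero, enorm_zero, ne_eq, OfNat.ofNat_ne_zero, not_false_eq_true, zero_pow,
      lintegral_zero, zero_add]
    refine ENNReal.tsum_le_tsum fun n => ?_
    have h := lintegral_creationFun_sq_le (a := fun _ => 1) (f := g) measurable_const (by simp)
      (by simp) hg (Ψ.measurable_toFun n) (Ψ.aesymmetric n)
    rw [hg1, lintegral_const_mul _ ((measurable_creationFun hg Ψ (n + 1)).enorm.pow_const 2)] at h
    simp only [Finset.sum_const, Finset.card_univ, Fintype.card_fin, nsmul_eq_mul, mul_one,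
      Nat.cast_add, Nat.cast_one] at h
    -- With `a = 1` the weight in the creation estimate is `(n + 1)⁻¹`; clearing it leaves the
    -- number factor.
    calc _ = (n + 1 : ℝ≥0∞) * ((n + 1 : ℝ≥0∞)⁻¹ *
          ∫⁻ k, ‖creationFun g Ψ.toFun (n + 1) k‖ₑ ^ 2 ∂nMeasure μ (n + 1)) := by
          rw [← mul_assoc, ENNReal.mul_inv_cancel (by simp) (by finiteness), one_mul]
      _ ≤ (n + 1 : ℝ≥0∞) * (‖g‖ₑ ^ 2 * ∫⁻ k, ‖Ψ.toFun n k‖ₑ ^ 2 ∂nMeasure μ n) := by gcongr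
      _ = _ := by ring
  exact ⟨Ξ, hdom, hΞ⟩

end Operators

end SingularFock

end

theorem proposition3p3 {X : Type*} [MeasurableSpace X] (μ : MeasureTheory.Measure X)
    [MeasureTheory.SigmaFinite μ] (ω : X → ℝ) (hω : Measurable ω)
    (m : ℝ) (hm : 0 < m) (hmω : ∀ k, m ≤ ω k)
    (s : ℝ) (hs : 1 ≤ s) (f : SingularFock.OneParticleScale μ ω (-s)) :
    ∃ A : SingularFock.FockScale μ ω s →L[ℂ] SingularFock.Fock μ,
      SingularFock.IsSingularAnnihilation f A ∧
      ∃ B : SingularFock.Fock μ →L[ℂ] SingularFock.FockScale μ ω (-s),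
        SingularFock.IsPairingAdjoint A B ∧
        (∀ B' : SingularFock.Fock μ →L[ℂ] SingularFock.FockScale μ ω (-s),
          SingularFock.IsPairingAdjoint A B' → B' = B) ∧
        ‖B‖ ≤ ‖f‖ ∧
        (∀ Ψ : SingularFock.Fock μ, SingularFock.MemScale ω s Ψ →
          ∀ n, (B Ψ).toFun n =ᵐ[SingularFock.nMeasure μ n]
            SingularFock.creationFun f Ψ.toFun n) ∧
        (∀ g : Lp ℂ 2 μ, f =ᵐ[μ] g →
          ∀ Ψ : SingularFock.Fock μ, SingularFock.MemScale ω 1 Ψ →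
            ∃ Ξ : SingularFock.Fock μ, SingularFock.IsRegularCreation g Ψ Ξ ∧
              ∀ n, (B Ψ).toFun n =ᵐ[SingularFock.nMeasure μ n] Ξ.toFun n) := by
  have hpos : ∀ x, 0 < ω x := fun x => hm.trans_le (hmω x)
  obtain ⟨A, hA⟩ := SingularFock.exists_isSingularAnnihilation hω hpos hs f
  obtain ⟨B, hB, hBf⟩ := SingularFock.exists_singularCreation hω hpos hs f
  have hAB := SingularFock.isPairingAdjoint_of_creationFun hω hpos hs hA hB
  refine ⟨A, hA, B, hAB, fun B' hB' => ?_, hBf, fun Ψ _ => hB Ψ, fun g hfg Ψ hΨ => ?_⟩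
  · ext1 Ψ
    -- Both adjoints pair with every `Φ` as `⟨Ψ, AΦ⟩`, and the pairing is nondegenerate.
    exact SingularFock.eq_of_pairing_eq hω hpos fun Φ => by rw [← hB' Φ Ψ, ← hAB Φ Ψ]
  · obtain ⟨Ξ, hΞ⟩ := SingularFock.exists_isRegularCreation hω hm hmω g hΨ
    refine ⟨Ξ, hΞ, fun n => (hB Ψ n).trans ?_⟩
    exact (SingularFock.creationFun_congr_ae hfg Ψ.aesymmetric
      (fun _ => Filter.EventuallyEq.rfl) n).trans (hΞ.2 n).symm
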